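/- Let $X$ be a locally compact, second countable Hausdorff space, let $\mu$ be a Radon measure on $X$ with $\mu(U)>0$ for every non-empty open $U\subset X$, and let $(\mathcal{E},\mathcal{F})$ be a symmetric, local, regular Dirichlet form on $L_2(X,\mu)$ (local: $\mathcal{E}(u,v)=0$ whenever $u,v\in\mathcal{F}$ have disjoint compact supports). Write $\mathcal{E}(u)=\mathcal{E}(u,u)$ and $\mathcal{E}_1(u)=\mathcal{E}(u)+\|u\|_{L_2(X,\mu)}^2$, and let $\mathcal{C}=C_0(X)\cap\mathcal{F}$, where $C_0(X)$ denotes the continuous real functions with compact support. For $g,h\in\mathcal{C}$ let $\Gamma(g,h)$ be the mutual energy measure, that is, the unique finite signed Borel measure with $$2\int_X f\,d\Gamma(g,h)=\mathcal{E}(fg,h)+\mathcal{E}(fh,g)-\mathcal{E}(gh,f)\qquad\text{for all } f\in\mathcal{C},$$ and let $\Gamma(g)=\Gamma(g,g)\ge 0$. Let $(\psi_n)_{n\ge 0}$ be a sequence in $\mathcal{C}$ that is $\mathcal{E}_1$-dense in $\mathcal{F}$ and satisfies $\mathcal{E}(\psi_n)>0$ for all $n$, and set $$f_n=\frac{\psi_n}{\Gamma(\psi_n)(X)^{1/2}},\qquad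 \widetilde m=\sum_{n=0}^\infty 2^{-n}\,\Gamma(f_n).$$ Then $\widetilde m$ is a finite measure, for every $g\in\mathcal{C}$ the energy measure $\Gamma(g)$ is absolutely continuous with respect to $\widetilde m$ with density in $L_1(X,\widetilde m)$, and $\{f_n\}_{n\ge 0}$ is a set of continuous coordinates for $\mathcal{E}$ with respect to $\widetilde m$, that is: 1. for all $i,j$ the measure $\Gamma(f_i,f_j)$ is absolutely continuous with respect to $\widetilde m$ with density in $L_1(X,\widetilde m)\cap L_\infty(X,\widetilde m)$; 2. the cylinder functions $F(f_{i_1},\dots,f_{i_k})$, where $k\in\mathbb{N}$, $i_1,\dots,i_k\in\mathbb{N}$ and $F\in C^1(\mathbb{R}^k)$ is bounded with bounded first derivatives and $F(0)=0$, belong to $\mathcal{C}$ and are $\mathcal{E}_1$-dense in $\mathcal{C}$. -/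

import Mathlib

open MeasureTheory Filter Topology
open scoped ENNReal CompactlySupported

noncomputable section

/-- The class in `L₂(X, μ)` of a continuous function with compact support, as a linear map. -/
def ccToL2 {X : Type*} [TopologicalSpace X] [MeasurableSpace X] [BorelSpace X]
    (μ : Measure X) [IsFiniteMeasureOnCompacts μ] : C_c(X, ℝ) →ₗ[ℝ] Lp ℝ 2 μ where
  toFun f := (f.continuous.memLp_of_hasCompactSupport (μ := μ) (p := 2)
    f.hasCompactSupport).toLp f
  map_add' f g := by
    rw [← MemLp.toLp_add]
    rfl
  map_smul' c f := by
    rw [RingHom.id_apply, ← MemLp.toLp_const_smul]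
    rfl

/-- A symmetric Dirichlet form on `L₂(X, μ)`: a densely defined, symmetric, nonnegative definite,
closed bilinear form on which the unit contraction operates. -/
structure SymmDirichletForm {X : Type*} [MeasurableSpace X] (μ : Measure X) where
  /-- the domain `𝓕` -/
  domain : Submodule ℝ (Lp ℝ 2 μ)
  /-- the form `𝓔` -/
  form : domain →ₗ[ℝ] domain →ₗ[ℝ] ℝ
  dense_domain : Dense (domain : Set (Lp ℝ 2 μ))
  symm : ∀ u v : domain, form u v = form v u
  nonneg : ∀ u : domain, 0 ≤ form u u
  closed : ∀ u : ℕ → domain,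
    (∀ ε : ℝ, 0 < ε → ∃ N : ℕ, ∀ m n : ℕ, N ≤ m → N ≤ n →
      form (u m - u n) (u m - u n) + ‖u m - u n‖ ^ 2 < ε) →
    ∃ v : domain,
      Tendsto (fun n => form (u n - v) (u n - v) + ‖u n - v‖ ^ 2) atTop (𝓝 0)
  markov : ∀ u : domain, ∃ v : domain,
    (∀ᵐ x ∂μ, (v : Lp ℝ 2 μ) x = min (max ((u : Lp ℝ 2 μ) x) 0) 1) ∧ form v v ≤ form u u

namespace SymmDirichletForm

section General

variable {X : Type*} [MeasurableSpace X] {μ : Measure X} (E : SymmDirichletForm μ)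

/-- `𝓔₁(u) = 𝓔(u, u) + ‖u‖²` with the norm of `L₂(X, μ)`. -/
def energyOne (u : E.domain) : ℝ := E.form u u + ‖u‖ ^ 2

open Classical in
/-- `𝓔(u, v)` for elements of `L₂(X, μ)`, extended by zero to elements outside the domain. -/
def formL2 (u v : Lp ℝ 2 μ) : ℝ :=
  if h : u ∈ E.domain ∧ v ∈ E.domain then E.form ⟨u, h.1⟩ ⟨v, h.2⟩ else 0

/-- Locality: `𝓔(u, v) = 0` whenever `u` and `v` in the domain have disjoint compact supports. -/
def IsLocal [TopologicalSpace X] : Prop :=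
  ∀ (u v : E.domain) (K L : Set X), IsCompact K → IsCompact L → Disjoint K L →
    (∀ᵐ x ∂μ, x ∉ K → (u : Lp ℝ 2 μ) x = 0) →
    (∀ᵐ x ∂μ, x ∉ L → (v : Lp ℝ 2 μ) x = 0) →
    E.form u v = 0

end General

section Core

variable {X : Type*} [TopologicalSpace X] [MeasurableSpace X] [BorelSpace X]
  {μ : Measure X} [IsFiniteMeasureOnCompacts μ] (E : SymmDirichletForm μ)

/-- `𝓒`, the space of the continuous functions with compact support that lie in the domain. -/
def core : Submodule ℝ C_c(X, ℝ) := E.domain.comap (ccToL2 μ)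

/-- The inclusion of `𝓒` in the domain. -/
def coreIncl : E.core →ₗ[ℝ] E.domain :=
  ((ccToL2 μ).comp E.core.subtype).codRestrict E.domain fun f => f.2

/-- Regularity: `𝓒` is `𝓔₁`-dense in the domain, and uniformly dense in the space of the
continuous functions with compact support. -/
def IsRegular : Prop :=
  (∀ (u : E.domain) (ε : ℝ), 0 < ε → ∃ f : E.core, E.energyOne (u - E.coreIncl f) < ε) ∧
  (∀ (g : C_c(X, ℝ)) (ε : ℝ), 0 < ε → ∃ f : E.core, ∀ x, |g x - (f : C_c(X, ℝ)) x| < ε)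

/-- `𝓔(f, g)` for continuous functions with compact support. -/
def formCc (f g : C_c(X, ℝ)) : ℝ := E.formL2 (ccToL2 μ f) (ccToL2 μ g)

/-- The finite signed measure `ν` is the mutual energy measure `Γ(g, h)` of `g, h ∈ 𝓒`:
`2 ∫ f dν = 𝓔(f g, h) + 𝓔(f h, g) - 𝓔(g h, f)` for all `f ∈ 𝓒`. -/
def IsEnergyMeasure (g h : E.core) (ν : SignedMeasure X) : Prop :=
  ∀ f : E.core,
    2 * ν.integral (fun x => (f : C_c(X, ℝ)) x) (ContinuousLinearMap.lsmul ℝ ℝ).flip =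
      E.formCc (f.1 * g.1) h.1 + E.formCc (f.1 * h.1) g.1 - E.formCc (g.1 * h.1) f.1

open Classical in
/-- The energy measure `Γ(g) = Γ(g, g)` of `g ∈ 𝓒`, a finite nonnegative measure. (The value `0`
of the second case is never used: for a regular form the measure exists and is unique.) -/
def energyMeasure (g : E.core) : Measure X :=
  if h : ∃ (ν : Measure X) (_ : IsFiniteMeasure ν), E.IsEnergyMeasure g g ν.toSignedMeasure then
    h.choose
  else 0

/-- The function `ψ / Γ(ψ)(X) ^ (1/2)`. -/
def normalize (ψ : E.core) : E.core :=
  (Real.sqrt (E.energyMeasure ψ Set.univ).toReal)⁻¹ • ψ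

/-- The measure `∑ₙ 2⁻ⁿ Γ(fₙ)`. -/
def weightedEnergySum (f : ℕ → E.core) : Measure X :=
  Measure.sum fun n => ((2 : ℝ≥0∞)⁻¹ ^ n) • E.energyMeasure (f n)

/-- For every `g ∈ 𝓒` the energy measure of `g` is absolutely continuous with respect to `m`,
with a density in `L₁(X, m)`. -/
def IsEnergyDominant (m : Measure X) : Prop :=
  ∀ g : E.core, ∃ ρ : X → ℝ, MemLp ρ 1 m ∧ E.IsEnergyMeasure g g (m.withDensityᵥ ρ)

/-- `f = F(φ_{i₁}, …, φ_{i_k})` for some `k`, some indices and some `F ∈ C_b¹(ℝᵏ)` with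
`F(0) = 0`. -/
def IsCylinder {I : Type*} (φ : I → E.core) (f : X → ℝ) : Prop :=
  ∃ (k : ℕ) (i : Fin k → I) (F : (Fin k → ℝ) → ℝ),
    ContDiff ℝ 1 F ∧ (∃ M : ℝ, ∀ y, |F y| ≤ M ∧ ‖fderiv ℝ F y‖ ≤ M) ∧ F 0 = 0 ∧
    ∀ x, f x = F fun j => (φ (i j) : C_c(X, ℝ)) x

/-- The family `φ` in `𝓒` is a set of continuous coordinates for the form with respect to `m`:
all `Γ(φᵢ, φⱼ)` have a density in `L₁(X, m) ∩ L_∞(X, m)`, and the `C_b¹` cylinder functions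
belong to `𝓒` and are `𝓔₁`-dense in it. -/
def IsContinuousCoordinates {I : Type*} (φ : I → E.core) (m : Measure X) : Prop :=
  (∀ i j : I, ∃ ρ : X → ℝ, MemLp ρ 1 m ∧ MemLp ρ ∞ m ∧
    E.IsEnergyMeasure (φ i) (φ j) (m.withDensityᵥ ρ)) ∧
  (∀ f : X → ℝ, E.IsCylinder φ f → ∃ g : E.core, ∀ x, (g : C_c(X, ℝ)) x = f x) ∧
  (∀ (g : E.core) (ε : ℝ), 0 < ε → ∃ f : E.core,
    E.IsCylinder φ (f : C_c(X, ℝ)) ∧ E.energyOne (E.coreIncl (g - f)) < ε)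

end Core

end SymmDirichletForm

end

/-! The theorem follows from two properties of energy measures: Γ(g + h) ≤ 2Γ(g) + 2Γ(h)
(`IsRegular.energyMeasure_add_le`) and Γ(g)(X) ≤ 𝓔(g) (`IsRegular.energyMeasure_univ_le`). Each ψₙ
is a multiple of fₙ, so an m-null set A is null for every Γ(ψₙ). Hence Γ(g)(A) ≤ 2Γ(g - ψₙ)(A) ≤
2𝓔(g - ψₙ), which is arbitrarily small by density of (ψₙ), and Radon–Nikodym gives the density of
Γ(g).

For the coordinates, Γ(fₙ) ≤ 2ⁿ m, so Γ(fᵢ), Γ(fⱼ) and Γ(fᵢ + fⱼ) are all dominated by multiples of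
m and have bounded densities; polarization (`IsRegular.isEnergyMeasure_polarization`) passes to
Γ(fᵢ, fⱼ). Cylinder functions are dense because each ψₙ is one of them: a linear function of fₙ,
smoothly cut off outside the range of fₙ (`isCylinder_smul`).

The bulk of the work constructs Γ(g) from the axioms of the form. The operators b G_b are symmetric
and sub-Markovian, the forms b⟪u - b G_b u, u⟫ increase to 𝓔(u, u), and their boundedness puts u in
the domain (`mem_domain_of_approxForm_le`). Such an approximating form behaves like a jump form plus
a killing term: a sum of its values at pairs (Uᵢ, Vᵢ) is nonnegative as soon as ∑ UᵢVᵢ ≥ 0 at every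
point and ∑ (Uᵢ(x) - Uᵢ(y))(Vᵢ(x) - Vᵢ(y)) ≥ 0 for all x, y. This principle passes to 𝓔
(`sum_coreForm_nonneg`). Suitable choices of the pairs show that Lipschitz functions operate on 𝓒,
that 𝓒 is an algebra, and that the functional defining Γ(g) is positive and bounded; the Riesz
theorem then represents it (`IsRegular.exists_measure`). -/

noncomputable section

namespace SymmDirichletForm

/-! ### Resolvent and approximating forms -/

section Resolvent

open scoped RealInnerProductSpace

variable {X : Type*} [MeasurableSpace X] {μ : Measure X} (E : SymmDirichletForm μ)

/-- The functional `𝓔(φ, φ) + b ‖φ - v‖²`, whose minimizer is the resolvent of `v`. -/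
def penalty (b : ℝ) (v : Lp ℝ 2 μ) (φ : E.domain) : ℝ :=
  E.form φ φ + b * ‖(φ : Lp ℝ 2 μ) - v‖ ^ 2

theorem form_add_self (u v : E.domain) :
    E.form (u + v) (u + v) = E.form u u + 2 * E.form u v + E.form v v := by
  simp only [map_add, LinearMap.add_apply, E.symm v u]
  ring

theorem form_sub_self (u v : E.domain) :
    E.form (u - v) (u - v) = E.form u u - 2 * E.form u v + E.form v v := by
  simp only [map_sub, LinearMap.sub_apply, E.symm v u]
  ring

theorem penalty_nonneg {b : ℝ} (hb : 0 < b) (v : Lp ℝ 2 μ) (φ : E.domain) :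
    0 ≤ E.penalty b v φ :=
  add_nonneg (E.nonneg φ) (by positivity)

/-- The parallelogram law for a quadratic functional. Since the midpoint value is at least the
infimum, it makes minimizing sequences Cauchy for 𝓔₁. -/
theorem penalty_midpoint (b : ℝ) (v : Lp ℝ 2 μ) (φ χ : E.domain) :
    E.form (φ - χ) (φ - χ) + b * ‖φ - χ‖ ^ 2 =
      2 * E.penalty b v φ + 2 * E.penalty b v χ
        - 4 * E.penalty b v ((2 : ℝ)⁻¹ • (φ + χ)) := by
  have h1 : ‖((((2 : ℝ)⁻¹ • (φ + χ) : E.domain)) : Lp ℝ 2 μ) - v‖ ^ 2 =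
      4⁻¹ * ‖((φ : Lp ℝ 2 μ) - v) + ((χ : Lp ℝ 2 μ) - v)‖ ^ 2 := by
    have : ((((2 : ℝ)⁻¹ • (φ + χ) : E.domain)) : Lp ℝ 2 μ) - v =
        (2 : ℝ)⁻¹ • (((φ : Lp ℝ 2 μ) - v) + ((χ : Lp ℝ 2 μ) - v)) := by
      push_cast
      module
    rw [this, norm_smul, mul_pow]
    norm_num
  have h2 : ‖φ - χ‖ ^ 2 = ‖((φ : Lp ℝ 2 μ) - v) - ((χ : Lp ℝ 2 μ) - v)‖ ^ 2 := by
    rw [sub_sub_sub_cancel_right]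
    rfl
  have h3 := parallelogram_law_with_norm ℝ ((φ : Lp ℝ 2 μ) - v) ((χ : Lp ℝ 2 μ) - v)
  unfold penalty
  rw [h1, h2, form_sub_self]
  simp only [map_smul, LinearMap.smul_apply, form_add_self, smul_eq_mul]
  linear_combination b * h3

/-- Completing the square at a solution `w` of the Euler–Lagrange identity of the penalty
functional. -/
theorem penalty_eq {b : ℝ} {v : Lp ℝ 2 μ} {w : E.domain}
    (hw : ∀ φ : E.domain, E.form w φ = b * ⟪v - w, (φ : Lp ℝ 2 μ)⟫) (φ : E.domain) :
    E.penalty b v φ = b * ⟪v - w, v⟫ + E.form (φ - w) (φ - w) + b * ‖φ - w‖ ^ 2 := by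
  have h2 : ‖φ - w‖ ^ 2 = ‖(φ : Lp ℝ 2 μ) - w‖ ^ 2 := rfl
  have h3 := hw φ
  have h4 := hw w
  unfold penalty
  rw [h2, form_sub_self, E.symm φ w, h3, h4]
  simp only [← real_inner_self_eq_norm_sq, inner_sub_left, inner_sub_right]
  rw [real_inner_comm v (φ : Lp ℝ 2 μ), real_inner_comm (w : Lp ℝ 2 μ) v,
    real_inner_comm (w : Lp ℝ 2 μ) (φ : Lp ℝ 2 μ)]
  ring

theorem form_sq_le (u v : E.domain) : E.form u v ^ 2 ≤ E.form u u * E.form v v := by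
  have h : ∀ t : ℝ, 0 ≤ E.form v v * (t * t) + (2 * E.form u v) * t + E.form u u := by
    intro t
    have := E.nonneg (u + t • v)
    rw [form_add_self] at this
    simp only [map_smul, LinearMap.smul_apply, smul_eq_mul] at this
    linarith
  have := discrim_le_zero h
  unfold discrim at this
  linarith

theorem tendsto_form_self {u : ℕ → E.domain} {w : E.domain}
    (h : Tendsto (fun n => E.form (u n - w) (u n - w)) atTop (𝓝 0)) :
    Tendsto (fun n => E.form (u n) (u n)) atTop (𝓝 (E.form w w)) := by
  have h1 : Tendsto (fun n => E.form (u n - w) w) atTop (𝓝 0) := by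
    have : Tendsto (fun n => Real.sqrt (E.form (u n - w) (u n - w) * E.form w w))
        atTop (𝓝 0) := by
      have := (h.mul_const (E.form w w)).sqrt
      simpa using this
    refine squeeze_zero_norm (fun n => ?_) this
    exact Real.abs_le_sqrt (E.form_sq_le _ _)
  have h2 : ∀ n, E.form (u n) (u n) =
      E.form (u n - w) (u n - w) + 2 * E.form (u n - w) w + E.form w w := by
    intro n
    rw [← form_add_self, sub_add_cancel]
  simp_rw [h2]
  simpa using (h.add (h1.const_mul 2)).add_const (E.form w w)

theorem tendsto_of_tendsto_energyOne {u : ℕ → E.domain} {w : E.domain}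
    (h : Tendsto (fun n => E.form (u n - w) (u n - w) + ‖u n - w‖ ^ 2) atTop (𝓝 0)) :
    Tendsto (fun n => E.form (u n) (u n)) atTop (𝓝 (E.form w w)) ∧
      Tendsto u atTop (𝓝 w) := by
  refine ⟨E.tendsto_form_self ?_, ?_⟩
  · exact squeeze_zero (fun n => E.nonneg _) (fun n => le_add_of_nonneg_right (by positivity)) h
  · have h1 : Tendsto (fun n => ‖u n - w‖ ^ 2) atTop (𝓝 0) :=
      squeeze_zero (fun n => by positivity) (fun n => le_add_of_nonneg_left (E.nonneg _)) h
    rw [tendsto_iff_norm_sub_tendsto_zero]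
    simpa using h1.sqrt

/-- The direct method: a minimizing sequence of the penalty functional converges in 𝓔₁ by
closedness, and the identity is the Euler–Lagrange equation of the minimizer. -/
theorem exists_resolvent {b : ℝ} (hb : 0 < b) (v : Lp ℝ 2 μ) :
    ∃ w : E.domain, ∀ φ : E.domain, E.form w φ = b * ⟪v - w, (φ : Lp ℝ 2 μ)⟫ := by
  have hbdd : BddBelow (Set.range (E.penalty b v)) :=
    ⟨0, by rintro _ ⟨φ, rfl⟩; exact E.penalty_nonneg hb v φ⟩
  set d := ⨅ φ, E.penalty b v φ with hd
  have hdle : ∀ φ, d ≤ E.penalty b v φ := fun φ => ciInf_le hbdd φ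
  have hex : ∀ n : ℕ, ∃ φ, E.penalty b v φ < d + 1 / ((n : ℝ) + 1) := fun n =>
    exists_lt_of_ciInf_lt (lt_add_of_pos_right _ (by positivity))
  choose u hu using hex
  have hlim : Tendsto (fun n : ℕ => 1 / ((n : ℝ) + 1)) atTop (𝓝 0) :=
    tendsto_one_div_add_atTop_nhds_zero_nat
  obtain ⟨w, hw⟩ := E.closed u (by
    intro ε hε
    -- If both penalties are within δ of the infimum, `penalty_midpoint` bounds the left side by 4δ.
    -- The factor `min 1 b` compares 𝓔 + b‖·‖² with 𝓔₁.
    obtain ⟨N, hN⟩ := eventually_atTop.1 (hlim.eventually_lt_const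
      (show 0 < ε * min 1 b / 4 by positivity))
    refine ⟨N, fun m n hm hn => ?_⟩
    have h1 := E.penalty_midpoint b v (u m) (u n)
    have h2 := hdle ((2 : ℝ)⁻¹ • (u m + u n))
    have h3 := hu m
    have h4 := hu n
    have h5 := hN m hm
    have h6 := hN n hn
    have h7 : min 1 b * (E.form (u m - u n) (u m - u n) + ‖u m - u n‖ ^ 2) ≤
        E.form (u m - u n) (u m - u n) + b * ‖u m - u n‖ ^ 2 := by
      rw [mul_add]
      refine add_le_add (mul_le_of_le_one_left (E.nonneg _) (min_le_left _ _)) ?_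
      gcongr
      exact min_le_right _ _
    have h8 : min 1 b * (E.form (u m - u n) (u m - u n) + ‖u m - u n‖ ^ 2) < min 1 b * ε := by
      linarith
    exact lt_of_mul_lt_mul_left h8 (by positivity))
  obtain ⟨hw1, hw2⟩ := E.tendsto_of_tendsto_energyOne hw
  have hwmin : E.penalty b v w ≤ d := by
    have h1 : Tendsto (fun n => E.penalty b v (u n)) atTop (𝓝 (E.penalty b v w)) := by
      refine hw1.add (Tendsto.const_mul b (Tendsto.pow (Tendsto.norm (Tendsto.sub_const ?_ v)) 2))
      exact (continuous_subtype_val.tendsto w).comp hw2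
    have h2 : Tendsto (fun n : ℕ => d + 1 / ((n : ℝ) + 1)) atTop (𝓝 d) := by
      simpa using hlim.const_add d
    exact le_of_tendsto_of_tendsto' h1 h2 fun n => (hu n).le
  refine ⟨w, fun φ => ?_⟩
  -- Minimality along the line w + tφ: a nonnegative quadratic in t with zero constant term must
  -- have zero linear coefficient.
  have key : ∀ t : ℝ, 0 ≤ (E.form φ φ + b * ‖(φ : Lp ℝ 2 μ)‖ ^ 2) * (t * t) +
      (2 * (E.form w φ + b * ⟪(w : Lp ℝ 2 μ) - v, (φ : Lp ℝ 2 μ)⟫)) * t + 0 := by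
    intro t
    have h1 := hwmin.trans (hdle (w + t • φ))
    unfold penalty at h1
    have h2 : (((w + t • φ : E.domain)) : Lp ℝ 2 μ) - v =
        ((w : Lp ℝ 2 μ) - v) + t • (φ : Lp ℝ 2 μ) := by
      push_cast
      abel
    rw [h2, form_add_self, norm_add_sq_real, norm_smul, mul_pow, real_inner_smul_right] at h1
    simp only [map_smul, LinearMap.smul_apply, smul_eq_mul, Real.norm_eq_abs, sq_abs] at h1
    linarith
  have h3 := discrim_le_zero key
  unfold discrim at h3
  have h4 : E.form w φ + b * ⟪(w : Lp ℝ 2 μ) - v, (φ : Lp ℝ 2 μ)⟫ = 0 := by nlinarith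
  rw [← neg_sub (w : Lp ℝ 2 μ) v, inner_neg_left]
  linarith

/-- The identity `𝓔(w, φ) = b ⟪v - w, φ⟫` for all `φ` determines `w`. -/
theorem resolvent_unique {b : ℝ} (hb : 0 < b) {v : Lp ℝ 2 μ} {w w' : E.domain}
    (hw : ∀ φ : E.domain, E.form w φ = b * ⟪v - w, (φ : Lp ℝ 2 μ)⟫)
    (hw' : ∀ φ : E.domain, E.form w' φ = b * ⟪v - w', (φ : Lp ℝ 2 μ)⟫) : w = w' := by
  have h1 := hw (w - w')
  have h2 := hw' (w - w')
  have h3 := E.nonneg (w - w')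
  have h4 : E.form (w - w') (w - w') = - (b * ‖w - w'‖ ^ 2) := by
    have : ‖w - w'‖ ^ 2 = ⟪(w : Lp ℝ 2 μ) - w', ((w - w' : E.domain) : Lp ℝ 2 μ)⟫ := by
      rw [← real_inner_self_eq_norm_sq]
      rfl
    rw [LinearMap.map_sub₂, h1, h2, this]
    simp only [inner_sub_left]
    ring
  have h5 : ‖w - w'‖ ^ 2 ≤ 0 := by
    by_contra hcon
    nlinarith [mul_pos hb (not_le.1 hcon)]
  have h6 : ‖w - w'‖ = 0 := by
    have := sq_nonneg ‖w - w'‖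
    exact pow_eq_zero_iff (two_ne_zero) |>.1 (le_antisymm h5 this)
  exact sub_eq_zero.1 (norm_eq_zero.1 h6)

/-- The operator `b G_b`, where `G_b` is the resolvent of the form. -/
def resolvent {b : ℝ} (hb : 0 < b) (v : Lp ℝ 2 μ) : E.domain := (E.exists_resolvent hb v).choose

variable {b : ℝ} (hb : 0 < b)

theorem form_resolvent (v : Lp ℝ 2 μ) (φ : E.domain) :
    E.form (E.resolvent hb v) φ = b * ⟪v - E.resolvent hb v, (φ : Lp ℝ 2 μ)⟫ :=
  (E.exists_resolvent hb v).choose_spec φ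

theorem resolvent_add (u v : Lp ℝ 2 μ) :
    E.resolvent hb (u + v) = E.resolvent hb u + E.resolvent hb v := by
  refine E.resolvent_unique hb (E.form_resolvent hb _) fun φ => ?_
  rw [map_add, LinearMap.add_apply, form_resolvent, form_resolvent]
  push_cast
  simp only [inner_sub_left, inner_add_left]
  ring

theorem resolvent_smul (c : ℝ) (v : Lp ℝ 2 μ) :
    E.resolvent hb (c • v) = c • E.resolvent hb v := by
  refine E.resolvent_unique hb (E.form_resolvent hb _) fun φ => ?_
  rw [map_smul, LinearMap.smul_apply, form_resolvent]
  push_cast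
  simp only [inner_sub_left, real_inner_smul_left, smul_eq_mul]
  ring

theorem inner_resolvent_comm (u v : Lp ℝ 2 μ) :
    ⟪(E.resolvent hb u : Lp ℝ 2 μ), v⟫ = ⟪u, (E.resolvent hb v : Lp ℝ 2 μ)⟫ := by
  have h1 := E.form_resolvent hb u (E.resolvent hb v)
  have h2 := E.form_resolvent hb v (E.resolvent hb u)
  rw [E.symm, h1] at h2
  have h3 := mul_left_cancel₀ hb.ne' h2
  simp only [inner_sub_left] at h3
  rw [real_inner_comm (E.resolvent hb u : Lp ℝ 2 μ) (E.resolvent hb v : Lp ℝ 2 μ)] at h3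
  rw [real_inner_comm]
  linarith

theorem norm_resolvent_le (v : Lp ℝ 2 μ) : ‖(E.resolvent hb v : Lp ℝ 2 μ)‖ ≤ ‖v‖ := by
  have h1 := E.form_resolvent hb v (E.resolvent hb v)
  have h2 := E.nonneg (E.resolvent hb v)
  rw [h1, inner_sub_left, real_inner_self_eq_norm_sq] at h2
  have h3 := nonneg_of_mul_nonneg_right h2 hb
  have h4 := real_inner_le_norm v (E.resolvent hb v : Lp ℝ 2 μ)
  by_contra hcon
  push Not at hcon
  nlinarith [norm_nonneg v, norm_nonneg (E.resolvent hb v : Lp ℝ 2 μ)]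

/-- The operator `b G_b` as a continuous linear map on `L₂(X, μ)`. -/
def resolventCLM : Lp ℝ 2 μ →L[ℝ] Lp ℝ 2 μ :=
  LinearMap.mkContinuous
    { toFun := fun v => (E.resolvent hb v : Lp ℝ 2 μ)
      map_add' := fun u v => by rw [resolvent_add]; rfl
      map_smul' := fun c v => by rw [resolvent_smul]; rfl } 1
    fun v => by simpa using E.norm_resolvent_le hb v

theorem resolventCLM_apply (v : Lp ℝ 2 μ) :
    E.resolventCLM hb v = (E.resolvent hb v : Lp ℝ 2 μ) := rfl

/-- Clamping the resolvent to [0, 1] increases neither the energy (Markov axiom) nor the distance to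
u, because clamping is 1-Lipschitz and fixes u. The clamped function is thus also a minimizer, and
`penalty_eq` forces it to equal the resolvent. -/
theorem resolvent_markov {u : Lp ℝ 2 μ} (h0 : ∀ᵐ x ∂μ, 0 ≤ u x) (h1 : ∀ᵐ x ∂μ, u x ≤ 1) :
    (∀ᵐ x ∂μ, 0 ≤ E.resolventCLM hb u x) ∧ ∀ᵐ x ∂μ, E.resolventCLM hb u x ≤ 1 := by
  rw [resolventCLM_apply]
  obtain ⟨w, hw, hle⟩ := E.markov (E.resolvent hb u)
  have hnorm : ‖(w : Lp ℝ 2 μ) - u‖ ≤ ‖(E.resolvent hb u : Lp ℝ 2 μ) - u‖ := by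
    refine Lp.norm_le_norm_of_ae_le ?_
    filter_upwards [hw, h0, h1, Lp.coeFn_sub (w : Lp ℝ 2 μ) u,
      Lp.coeFn_sub (E.resolvent hb u : Lp ℝ 2 μ) u] with x hx hx0 hx1 hs1 hs2
    rw [hs1, hs2, Pi.sub_apply, Pi.sub_apply, hx, Real.norm_eq_abs, Real.norm_eq_abs]
    have : u x = min (max (u x) 0) 1 := by
      rw [max_eq_left hx0, min_eq_left hx1]
    nth_rewrite 1 [this]
    exact (abs_min_sub_min_le_max _ _ _ _).trans (max_le ((abs_max_sub_max_le_max _ _ _ _).trans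
      (by simp)) (by simp))
  have hp : E.penalty b u w ≤ E.penalty b u (E.resolvent hb u) := by
    unfold penalty
    gcongr
  have hr := E.form_resolvent hb u
  rw [E.penalty_eq hr w, E.penalty_eq hr (E.resolvent hb u)] at hp
  rw [sub_self (E.resolvent hb u), LinearMap.map_zero, norm_zero] at hp
  have h2 := E.nonneg (w - E.resolvent hb u)
  have h3 : b * ‖w - E.resolvent hb u‖ ^ 2 ≤ 0 := by
    rw [zero_pow two_ne_zero, mul_zero] at hp
    linarith
  have h4 : ‖w - E.resolvent hb u‖ = 0 := by
    have h5 : ‖w - E.resolvent hb u‖ ^ 2 ≤ 0 := by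
      by_contra hcon
      nlinarith [mul_pos hb (not_le.1 hcon)]
    exact pow_eq_zero_iff two_ne_zero |>.1 (le_antisymm h5 (sq_nonneg _))
  have h5 : w = E.resolvent hb u := sub_eq_zero.1 (norm_eq_zero.1 h4)
  rw [← h5]
  refine ⟨?_, ?_⟩
  · filter_upwards [hw] with x hx
    rw [hx]
    exact le_min (le_max_right _ _) zero_le_one
  · filter_upwards [hw] with x hx
    rw [hx]
    exact min_le_right _ _

/-- The approximating form `b ⟪u - b G_b u, v⟫`. -/
def approxForm (u v : Lp ℝ 2 μ) : ℝ := b * ⟪u - E.resolventCLM hb u, v⟫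

theorem approxForm_comm (u v : Lp ℝ 2 μ) : E.approxForm hb u v = E.approxForm hb v u := by
  unfold approxForm
  rw [inner_sub_left, inner_sub_left, resolventCLM_apply, resolventCLM_apply,
    inner_resolvent_comm, real_inner_comm u v, real_inner_comm u (E.resolvent hb v : Lp ℝ 2 μ)]

theorem approxForm_add_self (u v : Lp ℝ 2 μ) : E.approxForm hb (u + v) (u + v) =
    E.approxForm hb u u + 2 * E.approxForm hb u v + E.approxForm hb v v := by
  have h := E.approxForm_comm hb v u
  unfold approxForm at *
  simp only [map_add, inner_sub_left, inner_add_left, inner_add_right] at *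
  linarith

theorem approxForm_self (v : Lp ℝ 2 μ) :
    E.approxForm hb v v = E.penalty b v (E.resolvent hb v) := by
  rw [E.penalty_eq (E.form_resolvent hb v)]
  simp [approxForm, resolventCLM_apply]

theorem penalty_eq_approxForm (v : Lp ℝ 2 μ) (φ : E.domain) :
    E.penalty b v φ = E.approxForm hb v v +
      E.form (φ - E.resolvent hb v) (φ - E.resolvent hb v) + b * ‖φ - E.resolvent hb v‖ ^ 2 :=
  E.penalty_eq (E.form_resolvent hb v) φ

theorem approxForm_self_le (v : E.domain) :
    E.approxForm hb (v : Lp ℝ 2 μ) v ≤ E.form v v := by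
  have h := E.penalty_eq_approxForm hb (v : Lp ℝ 2 μ) v
  have h1 : E.penalty b (v : Lp ℝ 2 μ) v = E.form v v := by simp [penalty]
  have h2 := E.nonneg (v - E.resolvent hb (v : Lp ℝ 2 μ))
  have h3 : 0 ≤ b * ‖v - E.resolvent hb (v : Lp ℝ 2 μ)‖ ^ 2 := by positivity
  linarith

/-- The b-penalty at the c-resolvent is at most the c-penalty there, and `penalty_eq_approxForm`
expands the former. This gives both monotonicity in b and control of the differences of resolvents.
-/
theorem approxForm_self_add_le {c : ℝ} (hc : 0 < c) (hbc : b ≤ c) (v : Lp ℝ 2 μ) :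
    E.approxForm hb v v + E.form (E.resolvent hc v - E.resolvent hb v)
      (E.resolvent hc v - E.resolvent hb v) + b * ‖E.resolvent hc v - E.resolvent hb v‖ ^ 2 ≤
    E.approxForm hc v v := by
  rw [← E.penalty_eq_approxForm hb, E.approxForm_self hc]
  unfold penalty
  gcongr

theorem natCast_succ_pos (n : ℕ) : (0 : ℝ) < n + 1 := by positivity

/-- If the approximating forms of `v` are bounded, then `v` is in the domain, and the approximating
forms converge to the form. -/
theorem mem_domain_of_approxForm_le {v : Lp ℝ 2 μ} {C : ℝ}
    (h : ∀ n : ℕ, E.approxForm (natCast_succ_pos n) v v ≤ C) :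
    ∃ hv : v ∈ E.domain, Tendsto (fun n : ℕ => E.approxForm (natCast_succ_pos n) v v) atTop
      (𝓝 (E.form ⟨v, hv⟩ ⟨v, hv⟩)) := by
  set a : ℕ → ℝ := fun n => E.approxForm (natCast_succ_pos n) v v with ha
  set w : ℕ → E.domain := fun n => E.resolvent (natCast_succ_pos n) v with hw
  -- The 𝓔₁-distance of two resolvents is controlled by the increment of a bounded monotone
  -- sequence, so they are Cauchy. Using parameters n + 1 ≥ 1 allows the factor b to be dropped.
  have hstep : ∀ m n, m ≤ n →
      E.form (w n - w m) (w n - w m) + ‖w n - w m‖ ^ 2 ≤ a n - a m := by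
    intro m n hmn
    have h1 := E.approxForm_self_add_le (natCast_succ_pos m) (natCast_succ_pos n)
      (by gcongr) v
    have h2 : ‖w n - w m‖ ^ 2 ≤ ((m : ℝ) + 1) * ‖w n - w m‖ ^ 2 :=
      le_mul_of_one_le_left (by positivity) (by simp)
    simp only [hw, ha] at h1 h2 ⊢
    linarith
  have hmono : Monotone a := fun m n hmn => by
    have := hstep m n hmn
    have h2 := E.nonneg (w n - w m)
    nlinarith [sq_nonneg ‖w n - w m‖]
  have hconv : Tendsto a atTop (𝓝 (⨆ n, a n)) :=
    tendsto_atTop_ciSup hmono ⟨C, by rintro _ ⟨n, rfl⟩; exact h n⟩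
  obtain ⟨z, hz⟩ := E.closed w (by
    intro ε hε
    obtain ⟨N, hN⟩ := Metric.cauchySeq_iff.1 hconv.cauchySeq ε hε
    refine ⟨N, fun m n hm hn => ?_⟩
    have hd := hN m hm n hn
    rw [Real.dist_eq, abs_lt] at hd
    rcases le_total m n with hmn | hmn
    · have h1 := hstep m n hmn
      rw [← neg_sub (w n) (w m), norm_neg, map_neg, map_neg, LinearMap.neg_apply, neg_neg]
      linarith
    · have h1 := hstep n m hmn
      linarith)
  obtain ⟨hz1, hz2⟩ := E.tendsto_of_tendsto_energyOne hz
  have hself : ∀ n, a n = E.form (w n) (w n) + ((n : ℝ) + 1) * ‖(w n : Lp ℝ 2 μ) - v‖ ^ 2 :=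
    fun n => E.approxForm_self (natCast_succ_pos n) v
  have hz2' : Tendsto (fun n => (w n : Lp ℝ 2 μ)) atTop (𝓝 (z : Lp ℝ 2 μ)) :=
    (continuous_subtype_val.tendsto z).comp hz2
  -- Boundedness of the approximating forms gives (n + 1)‖wₙ - v‖² ≤ C, which identifies the
  -- 𝓔₁-limit z with v.
  have hv2 : Tendsto (fun n => (w n : Lp ℝ 2 μ)) atTop (𝓝 v) := by
    rw [tendsto_iff_norm_sub_tendsto_zero]
    have h1 : Tendsto (fun n : ℕ => C * (1 / ((n : ℝ) + 1))) atTop (𝓝 0) := by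
      simpa using tendsto_one_div_add_atTop_nhds_zero_nat.const_mul C
    have h2 : Tendsto (fun n => ‖(w n : Lp ℝ 2 μ) - v‖ ^ 2) atTop (𝓝 0) := by
      refine squeeze_zero (fun n => by positivity) (fun n => ?_) h1
      have h3 := hself n
      have h4 := E.nonneg (w n)
      have h5 := h n
      rw [mul_one_div, le_div_iff₀ (natCast_succ_pos n)]
      simp only [ha] at h3
      linarith
    simpa using h2.sqrt
  have hzv : (z : Lp ℝ 2 μ) = v := tendsto_nhds_unique hz2' hv2
  subst hzv
  refine ⟨z.2, ?_⟩
  refine tendsto_of_tendsto_of_tendsto_of_le_of_le hz1 tendsto_const_nhds (fun n => ?_)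
    (fun n => ?_)
  · rw [hself n]
    exact le_add_of_nonneg_right (by positivity)
  · exact E.approxForm_self_le _ z

theorem tendsto_approxForm_self (v : E.domain) :
    Tendsto (fun n : ℕ => E.approxForm (natCast_succ_pos n) (v : Lp ℝ 2 μ) v) atTop
      (𝓝 (E.form v v)) :=
  (E.mem_domain_of_approxForm_le fun n => E.approxForm_self_le (natCast_succ_pos n) v).2

theorem tendsto_approxForm (u v : E.domain) :
    Tendsto (fun n : ℕ => E.approxForm (natCast_succ_pos n) (u : Lp ℝ 2 μ) v) atTop
      (𝓝 (E.form u v)) := by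
  have h := (((E.tendsto_approxForm_self (u + v)).sub (E.tendsto_approxForm_self u)).sub
    (E.tendsto_approxForm_self v)).div_const 2
  have h1 : (E.form (u + v) (u + v) - E.form u u - E.form v v) / 2 = E.form u v := by
    rw [form_add_self]
    ring
  rw [h1] at h
  refine h.congr fun n => ?_
  push_cast
  rw [approxForm_add_self]
  ring

end Resolvent

end SymmDirichletForm

/-! ### Symmetric sub-Markovian operators on indicators -/

section SubMarkov

open scoped RealInnerProductSpace

/-- Algebraic core of the positivity of symmetric sub-Markovian quadratic expressions. -/
theorem sum_mul_sub_sum_mul_nonneg {κ : Type*} (T : Finset κ) (Q s : κ → κ → ℝ) (m : κ → ℝ)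
    (hs : ∀ y ∈ T, ∀ z ∈ T, 0 ≤ s y z) (hsymm : ∀ y z, s y z = s z y)
    (hsum : ∀ y ∈ T, ∑ z ∈ T, s y z ≤ m y) (hQ0 : ∀ y ∈ T, 0 ≤ Q y y)
    (hQ : ∀ y ∈ T, ∀ z ∈ T, 0 ≤ Q y y + Q z z - Q y z - Q z y) :
    0 ≤ ∑ y ∈ T, Q y y * m y - ∑ y ∈ T, ∑ z ∈ T, Q y z * s y z := by
  -- The expression splits into a killing part ∑ Q(y,y)(m(y) - ∑ s(y,z)) and a jump part ½ ∑ (Q(y,y)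
  -- + Q(z,z) - Q(y,z) - Q(z,y)) s(y,z); `h1` and `h2` are their signs.
  have h1 : 0 ≤ ∑ y ∈ T, Q y y * (m y - ∑ z ∈ T, s y z) :=
    Finset.sum_nonneg fun y hy => mul_nonneg (hQ0 y hy) (sub_nonneg.2 (hsum y hy))
  have h2 : 0 ≤ ∑ y ∈ T, ∑ z ∈ T, (Q y y + Q z z - Q y z - Q z y) * s y z :=
    Finset.sum_nonneg fun y hy => Finset.sum_nonneg fun z hz => mul_nonneg (hQ y hy z hz)
      (hs y hy z hz)
  have h3 : ∑ y ∈ T, ∑ z ∈ T, Q z z * s y z = ∑ y ∈ T, ∑ z ∈ T, Q y y * s y z := by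
    rw [Finset.sum_comm]
    exact Finset.sum_congr rfl fun y _ => Finset.sum_congr rfl fun z _ => by rw [hsymm]
  have h4 : ∑ y ∈ T, ∑ z ∈ T, Q z y * s y z = ∑ y ∈ T, ∑ z ∈ T, Q y z * s y z := by
    rw [Finset.sum_comm]
    exact Finset.sum_congr rfl fun y _ => Finset.sum_congr rfl fun z _ => by rw [hsymm]
  simp only [sub_mul, add_mul, Finset.sum_add_distrib, Finset.sum_sub_distrib] at h2
  simp only [mul_sub, Finset.sum_sub_distrib, Finset.mul_sum] at h1
  linarith

variable {X : Type*} [MeasurableSpace X] {μ : Measure X}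

/-- A symmetric operator on `L₂(X, μ)` which maps functions with values in `[0, 1]` to functions
with values in `[0, 1]`. -/
structure IsSymmSubMarkov (S : Lp ℝ 2 μ →L[ℝ] Lp ℝ 2 μ) : Prop where
  inner_comm : ∀ u v, ⟪S u, v⟫ = ⟪u, S v⟫
  nonneg : ∀ u : Lp ℝ 2 μ, (∀ᵐ x ∂μ, 0 ≤ u x) → (∀ᵐ x ∂μ, u x ≤ 1) → ∀ᵐ x ∂μ, 0 ≤ S u x
  le_one : ∀ u : Lp ℝ 2 μ, (∀ᵐ x ∂μ, 0 ≤ u x) → (∀ᵐ x ∂μ, u x ≤ 1) → ∀ᵐ x ∂μ, S u x ≤ 1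

namespace IsSymmSubMarkov

variable {S : Lp ℝ 2 μ →L[ℝ] Lp ℝ 2 μ} (hS : IsSymmSubMarkov S)
include hS

theorem inner_indicator_nonneg {A B : Set X} (hA : MeasurableSet A) (hμA : μ A ≠ ∞)
    (hB : MeasurableSet B) (hμB : μ B ≠ ∞) :
    0 ≤ ⟪S (indicatorConstLp 2 hA hμA 1), indicatorConstLp 2 hB hμB (1 : ℝ)⟫ := by
  rw [real_inner_comm, L2.inner_indicatorConstLp_one]
  refine setIntegral_nonneg_of_ae ?_
  refine hS.nonneg _ ?_ ?_
  · filter_upwards [indicatorConstLp_coeFn (p := 2) (hs := hA) (hμs := hμA) (c := (1 : ℝ))] with x hx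
    rw [hx]
    exact Set.indicator_nonneg (fun _ _ => zero_le_one) x
  · filter_upwards [indicatorConstLp_coeFn (p := 2) (hs := hA) (hμs := hμA) (c := (1 : ℝ))] with x hx
    rw [hx]
    exact Set.indicator_le_self' (fun _ _ => zero_le_one) x

theorem inner_indicator_le {u : Lp ℝ 2 μ} (h0 : ∀ᵐ x ∂μ, 0 ≤ u x) (h1 : ∀ᵐ x ∂μ, u x ≤ 1)
    {A : Set X} (hA : MeasurableSet A) (hμA : μ A ≠ ∞) :
    ⟪indicatorConstLp 2 hA hμA (1 : ℝ), S u⟫ ≤ μ.real A := by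
  rw [L2.inner_indicatorConstLp_one]
  have h2 : ∫ x in A, S u x ∂μ ≤ ∫ x in A, (1 : ℝ) ∂μ := by
    refine setIntegral_mono_ae ?_ ?_ (hS.le_one u h0 h1)
    · exact integrableOn_Lp_of_measure_ne_top (S u) (by norm_num) hμA
    · exact integrableOn_const hμA
  simpa using h2

end IsSymmSubMarkov

end SubMarkov

/-! ### From simple functions to square integrable functions -/

section SubMarkovSimple

open scoped RealInnerProductSpace

variable {X : Type*} [MeasurableSpace X] {μ : Measure X}

theorem Lp_coeFn_sum_smul {κ : Type*} (T : Finset κ) (c : κ → ℝ) (e : κ → Lp ℝ 2 μ)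
    (f : κ → X → ℝ) (h : ∀ y ∈ T, e y =ᵐ[μ] f y) :
    (∑ y ∈ T, c y • e y : Lp ℝ 2 μ) =ᵐ[μ] fun x => ∑ y ∈ T, c y * f y x := by
  classical
  induction T using Finset.induction_on with
  | empty =>
    simp only [Finset.sum_empty]
    exact Lp.coeFn_zero _ _ _
  | insert a T ha ih =>
    simp only [Finset.sum_insert ha]
    filter_upwards [ih fun y hy => h y (Finset.mem_insert_of_mem hy),
      h a (Finset.mem_insert_self a T), Lp.coeFn_add (c a • e a) (∑ y ∈ T, c y • e y),
      Lp.coeFn_smul (c a) (e a)] with x h1 h2 h3 h4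
    rw [h3, Pi.add_apply, h1, h4, Pi.smul_apply, h2, smul_eq_mul]

open Classical in
theorem simpleFunc_sum_indicator {F : Type*} [Zero F] (W : SimpleFunc X F) {T : Finset F}
    (hT : ∀ y, y ∈ T ↔ y ∈ W.range ∧ y ≠ 0) (c : F → ℝ) (x : X) :
    ∑ y ∈ T, c y * (W ⁻¹' {y}).indicator 1 x = if W x = 0 then 0 else c (W x) := by
  split_ifs with h
  · refine Finset.sum_eq_zero fun y hy => ?_
    rw [Set.indicator_of_notMem, mul_zero]
    intro hx
    have hx' : W x = y := hx
    exact ((hT y).1 hy).2 (hx' ▸ h)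
  · rw [Finset.sum_eq_single (W x)]
    · simp
    · intro y _ hy
      rw [Set.indicator_of_notMem, mul_zero]
      exact fun hx => hy (Eq.symm hx)
    · intro hx
      exact absurd ((hT _).2 ⟨SimpleFunc.mem_range_self W x, h⟩) hx

namespace IsSymmSubMarkov

variable {S : Lp ℝ 2 μ →L[ℝ] Lp ℝ 2 μ} (hS : IsSymmSubMarkov S)
include hS

-- All uᵢ and vᵢ are combinations of the indicators of the nonzero fibres of a single simple
-- function W, so the sum becomes the finite expression of `sum_mul_sub_sum_mul_nonneg`.
open Classical in
theorem sum_inner_simpleFunc_nonneg {ι : Type*} [Fintype ι]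
    (W : SimpleFunc X ((ι → ℝ) × (ι → ℝ))) (hW : MemLp W 2 μ)
    (hQ0 : ∀ x, 0 ≤ ∑ i, (W x).1 i * (W x).2 i)
    (hQ : ∀ x y, 0 ≤ ∑ i, ((W x).1 i - (W y).1 i) * ((W x).2 i - (W y).2 i))
    (u v : ι → Lp ℝ 2 μ) (hu : ∀ i, u i =ᵐ[μ] fun x => (W x).1 i)
    (hv : ∀ i, v i =ᵐ[μ] fun x => (W x).2 i) :
    0 ≤ ∑ i, ⟪u i - S (u i), v i⟫ := by
  set T := W.range.filter (· ≠ 0)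
  have hT : ∀ y, y ∈ T ↔ y ∈ W.range ∧ y ≠ 0 := fun y => Finset.mem_filter
  have hfin : ∀ y ∈ T, μ (W ⁻¹' {y}) ≠ ∞ := fun y hy =>
    (SimpleFunc.measure_preimage_lt_top_of_memLp two_ne_zero ENNReal.ofNat_ne_top W hW y
      ((hT y).1 hy).2).ne
  -- The default 0 is not reached for y in T: nonzero fibres of a square integrable simple function
  -- have finite measure.
  set e : (ι → ℝ) × (ι → ℝ) → Lp ℝ 2 μ := fun y =>
    if h : μ (W ⁻¹' {y}) ≠ ∞ then indicatorConstLp 2 (W.measurableSet_fiber y) h (1 : ℝ) else 0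
    with he
  have heq : ∀ y (hy : y ∈ T), e y = indicatorConstLp 2 (W.measurableSet_fiber y)
      (hfin y hy) (1 : ℝ) := fun y hy => by rw [he]; exact dif_pos (hfin y hy)
  have hecoe : ∀ y ∈ T, e y =ᵐ[μ] (W ⁻¹' {y}).indicator 1 := fun y hy => by
    rw [heq y hy]
    exact indicatorConstLp_coeFn
  have hrep : ∀ (c : (ι → ℝ) × (ι → ℝ) → ℝ) (g : Lp ℝ 2 μ), c 0 = 0 →
      (g =ᵐ[μ] fun x => c (W x)) → g = ∑ y ∈ T, c y • e y := by
    intro c g hc hg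
    refine Lp.ext ?_
    filter_upwards [hg, Lp_coeFn_sum_smul T c e _ hecoe] with x h1 h2
    rw [h1, h2, simpleFunc_sum_indicator W hT]
    split_ifs with h
    · rw [h, hc]
    · rfl
  have hinner : ∀ y ∈ T, ∀ z ∈ T, ⟪e y, e z⟫ = if y = z then μ.real (W ⁻¹' {y}) else 0 := by
    intro y hy z hz
    rw [heq y hy, heq z hz, L2.inner_indicatorConstLp_one]
    rw [setIntegral_congr_ae (W.measurableSet_fiber y)
      (indicatorConstLp_coeFn.mono fun x hx _ => hx),
      integral_indicator_const (1 : ℝ) (W.measurableSet_fiber z)]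
    rw [measureReal_restrict_apply (W.measurableSet_fiber z)]
    split_ifs with hyz
    · subst hyz
      simp
    · have : W ⁻¹' {z} ∩ W ⁻¹' {y} = ∅ := by
        rw [← Set.preimage_inter, Set.singleton_inter_eq_empty.2 (by simpa using Ne.symm hyz)]
        simp
      simp [this]
  have hone0 : ∀ᵐ x ∂μ, (∑ y ∈ T, (1 : ℝ) • e y : Lp ℝ 2 μ) x =
      if W x = 0 then 0 else 1 := by
    filter_upwards [Lp_coeFn_sum_smul T (fun _ => (1 : ℝ)) e _ hecoe] with x h2
    rw [h2, simpleFunc_sum_indicator W hT (fun _ => (1 : ℝ))]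
    split_ifs <;> rfl
  simp only [one_smul] at hone0
  have hexp : ∀ i, ⟪u i - S (u i), v i⟫ =
      ∑ y ∈ T, ∑ z ∈ T, y.1 i * z.2 i * (⟪e y, e z⟫ - ⟪S (e y), e z⟫) := by
    intro i
    rw [hrep (fun y => y.1 i) (u i) rfl (hu i), hrep (fun y => y.2 i) (v i) rfl (hv i)]
    simp only [map_sum, map_smul, inner_sub_left, sum_inner, inner_sum, real_inner_smul_left,
      real_inner_smul_right, ← Finset.sum_sub_distrib]
    rw [Finset.sum_comm]
    refine Finset.sum_congr rfl fun y _ => Finset.sum_congr rfl fun z _ => ?_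
    ring
  have hmem : ∀ y ∈ T, ∃ x, W x = y := fun y hy =>
    SimpleFunc.mem_range.1 ((hT y).1 hy).1
  -- The jump weights are s(y, z) = ⟪S 1_y, 1_z⟫. By symmetry their row sum is the integral over the
  -- fibre of S applied to the indicator of {W ≠ 0}, hence at most the measure of the fibre.
  have hmain := sum_mul_sub_sum_mul_nonneg T (fun y z => ∑ i, y.1 i * z.2 i)
    (fun y z => ⟪S (e y), e z⟫) (fun y => μ.real (W ⁻¹' {y}))
    (fun y hy z hz => by
      rw [heq y hy, heq z hz]
      exact hS.inner_indicator_nonneg _ _ _ _)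
    (fun y z => by rw [hS.inner_comm, real_inner_comm])
    (fun y hy => by
      rw [← inner_sum, hS.inner_comm, heq y hy]
      refine hS.inner_indicator_le ?_ ?_ _ _
      · filter_upwards [hone0] with x hx
        rw [hx]
        split_ifs <;> norm_num
      · filter_upwards [hone0] with x hx
        rw [hx]
        split_ifs <;> norm_num)
    (fun y hy => by
      obtain ⟨x, rfl⟩ := hmem y hy
      exact hQ0 x)
    (fun y hy z hz => by
      obtain ⟨x, rfl⟩ := hmem y hy
      obtain ⟨x', rfl⟩ := hmem z hz
      refine (hQ x x').trans_eq ?_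
      rw [← Finset.sum_add_distrib, ← Finset.sum_sub_distrib, ← Finset.sum_sub_distrib]
      exact Finset.sum_congr rfl fun i _ => by ring)
  refine hmain.trans_eq (((Finset.sum_congr rfl fun i _ => hexp i).trans
    (Finset.sum_comm.trans ?_)).symm)
  rw [← Finset.sum_sub_distrib]
  refine Finset.sum_congr rfl fun y hy => ?_
  rw [Finset.sum_comm]
  have h1 : ∀ z ∈ T, ∑ i, y.1 i * z.2 i * (⟪e y, e z⟫ - ⟪S (e y), e z⟫) =
      (if y = z then (∑ i, y.1 i * z.2 i) * μ.real (W ⁻¹' {y}) else 0) -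
        (∑ i, y.1 i * z.2 i) * ⟪S (e y), e z⟫ := by
    intro z hz
    rw [← Finset.sum_mul, hinner y hy z hz, mul_sub, mul_ite, mul_zero]
  rw [Finset.sum_congr rfl h1, Finset.sum_sub_distrib, Finset.sum_ite_eq, if_pos hy]

/-- Approximation in L₂ by simple functions whose values lie in the range of (U, V) or are 0, so
that the pointwise hypotheses hold exactly for the approximants. -/
theorem sum_inner_nonneg {ι : Type*} [Fintype ι] {U V : ι → X → ℝ}
    (hUm : ∀ i, Measurable (U i)) (hVm : ∀ i, Measurable (V i))
    (hU : ∀ i, MemLp (U i) 2 μ) (hV : ∀ i, MemLp (V i) 2 μ)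
    (hQ0 : ∀ x, 0 ≤ ∑ i, U i x * V i x)
    (hQ : ∀ x y, 0 ≤ ∑ i, (U i x - U i y) * (V i x - V i y)) :
    0 ≤ ∑ i, ⟪(hU i).toLp - S (hU i).toLp, (hV i).toLp⟫ := by
  set W : X → (ι → ℝ) × (ι → ℝ) := fun x => (fun i => U i x, fun i => V i x) with hW
  have hWm : Measurable W :=
    (measurable_pi_lambda _ hUm).prodMk (measurable_pi_lambda _ hVm)
  have hWL : MemLp W 2 μ :=
    MemLp.of_fst_snd ⟨MemLp.of_eval hU, MemLp.of_eval hV⟩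
  -- With the value 0 adjoined, `hQ0` is precisely the increment condition between a point of the
  -- range and 0.
  set s : Set ((ι → ℝ) × (ι → ℝ)) := insert 0 (Set.range W) with hs
  have h0 : (0 : (ι → ℝ) × (ι → ℝ)) ∈ s := Set.mem_insert _ _
  have hs0 : ∀ p ∈ s, 0 ≤ ∑ i, p.1 i * p.2 i := by
    rintro p (rfl | ⟨x, rfl⟩)
    · simp
    · exact hQ0 x
  have hsQ : ∀ p ∈ s, ∀ q ∈ s, 0 ≤ ∑ i, (p.1 i - q.1 i) * (p.2 i - q.2 i) := by
    rintro p (rfl | ⟨x, rfl⟩) q (rfl | ⟨y, rfl⟩)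
    · simp
    · simpa using hQ0 y
    · simpa using hQ0 x
    · exact hQ x y
  set A : ℕ → SimpleFunc X ((ι → ℝ) × (ι → ℝ)) := fun n => SimpleFunc.approxOn W hWm s 0 h0 n
    with hA
  have hAs : ∀ n x, A n x ∈ s := fun n x => SimpleFunc.approxOn_mem hWm h0 n x
  have hAL : ∀ n, MemLp (A n) 2 μ := fun n =>
    SimpleFunc.memLp_approxOn hWm hWL h0 MemLp.zero n
  have hAU : ∀ n i, MemLp (fun x => (A n x).1 i) 2 μ := fun n i => (hAL n).fst.eval i
  have hAV : ∀ n i, MemLp (fun x => (A n x).2 i) 2 μ := fun n i => (hAL n).snd.eval i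
  have hlim : Tendsto (fun n => eLpNorm (⇑(A n) - W) 2 μ) atTop (𝓝 0) := by
    refine SimpleFunc.tendsto_approxOn_Lp_eLpNorm hWm h0 ENNReal.ofNat_ne_top ?_ ?_
    · exact ae_of_all _ fun x => subset_closure (Set.mem_insert_of_mem _ (Set.mem_range_self x))
    · simpa using hWL.2
  have hUlim : ∀ i, Tendsto (fun n => (hAU n i).toLp) atTop (𝓝 (hU i).toLp) := by
    intro i
    rw [Lp.tendsto_Lp_iff_tendsto_eLpNorm'']
    refine tendsto_of_tendsto_of_tendsto_of_le_of_le tendsto_const_nhds hlim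
      (fun n => zero_le) fun n => eLpNorm_mono fun x => ?_
    exact (norm_le_pi_norm ((A n x - W x).1) i).trans (norm_fst_le _)
  have hVlim : ∀ i, Tendsto (fun n => (hAV n i).toLp) atTop (𝓝 (hV i).toLp) := by
    intro i
    rw [Lp.tendsto_Lp_iff_tendsto_eLpNorm'']
    refine tendsto_of_tendsto_of_tendsto_of_le_of_le tendsto_const_nhds hlim
      (fun n => zero_le) fun n => eLpNorm_mono fun x => ?_
    exact (norm_le_pi_norm ((A n x - W x).2) i).trans (norm_snd_le _)
  have hfinal : Tendsto (fun n => ∑ i, ⟪(hAU n i).toLp - S (hAU n i).toLp, (hAV n i).toLp⟫) atTop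
      (𝓝 (∑ i, ⟪(hU i).toLp - S (hU i).toLp, (hV i).toLp⟫)) := by
    refine tendsto_finsetSum _ fun i _ => Tendsto.inner ((hUlim i).sub ?_) (hVlim i)
    exact (S.continuous.tendsto _).comp (hUlim i)
  refine ge_of_tendsto' hfinal fun n => ?_
  exact hS.sum_inner_simpleFunc_nonneg (A n) (hAL n) (fun x => hs0 _ (hAs n x))
    (fun x y => hsQ _ (hAs n x) _ (hAs n y)) _ _ (fun i => (hAU n i).coeFn_toLp)
    (fun i => (hAV n i).coeFn_toLp)

end IsSymmSubMarkov

end SubMarkovSimple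

namespace SymmDirichletForm

theorem isSymmSubMarkov_resolventCLM {X : Type*} [MeasurableSpace X] {μ : Measure X}
    (E : SymmDirichletForm μ) {b : ℝ} (hb : 0 < b) : IsSymmSubMarkov (E.resolventCLM hb) where
  inner_comm := E.inner_resolvent_comm hb
  nonneg _ h0 h1 := (E.resolvent_markov hb h0 h1).1
  le_one _ h0 h1 := (E.resolvent_markov hb h0 h1).2

/-! ### The core as an algebra, and the energy functional -/

section CoreAlgebra

variable {X : Type*} [TopologicalSpace X] [MeasurableSpace X] [BorelSpace X]
  {μ : Measure X} [IsFiniteMeasureOnCompacts μ] (E : SymmDirichletForm μ)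

theorem sum_approxForm_nonneg {ι : Type*} [Fintype ι] {b : ℝ} (hb : 0 < b)
    (U V : ι → C_c(X, ℝ)) (hQ0 : ∀ x, 0 ≤ ∑ i, U i x * V i x)
    (hQ : ∀ x y, 0 ≤ ∑ i, (U i x - U i y) * (V i x - V i y)) :
    0 ≤ ∑ i, E.approxForm hb (ccToL2 μ (U i)) (ccToL2 μ (V i)) := by
  have h := (E.isSymmSubMarkov_resolventCLM hb).sum_inner_nonneg
    (fun i => (U i).continuous.measurable) (fun i => (V i).continuous.measurable)
    (fun i => (U i).continuous.memLp_of_hasCompactSupport (μ := μ) (p := 2) (U i).hasCompactSupport)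
    (fun i => (V i).continuous.memLp_of_hasCompactSupport (μ := μ) (p := 2) (V i).hasCompactSupport)
    hQ0 hQ
  have h2 := mul_nonneg hb.le h
  rw [Finset.mul_sum] at h2
  exact h2

/-- The form on the core, as a bilinear map. -/
def coreForm : E.core →ₗ[ℝ] E.core →ₗ[ℝ] ℝ := E.form.compl₁₂ E.coreIncl E.coreIncl

theorem coreForm_apply (f g : E.core) : E.coreForm f g = E.form (E.coreIncl f) (E.coreIncl g) := rfl

theorem coreForm_self_nonneg (f : E.core) : 0 ≤ E.coreForm f f := E.nonneg _

theorem coreForm_neg_left (f g : E.core) : E.coreForm (-f) g = -E.coreForm f g :=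
  E.coreForm.map_neg₂ f g

theorem coreForm_sub_left (f f' g : E.core) :
    E.coreForm (f - f') g = E.coreForm f g - E.coreForm f' g :=
  E.coreForm.map_sub₂ f f' g

theorem coreForm_smul_left (c : ℝ) (f g : E.core) :
    E.coreForm (c • f) g = c * E.coreForm f g :=
  E.coreForm.map_smul₂ c f g

/-- The limit of `sum_approxForm_nonneg`. Inequalities for the form on the core reduce to choosing
pairs (Uᵢ, Vᵢ) and checking real algebra. -/
theorem sum_coreForm_nonneg {ι : Type*} [Fintype ι] (U V : ι → E.core)
    (hQ0 : ∀ x, 0 ≤ ∑ i, (U i : C_c(X, ℝ)) x * (V i : C_c(X, ℝ)) x)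
    (hQ : ∀ x y, 0 ≤ ∑ i, ((U i : C_c(X, ℝ)) x - (U i : C_c(X, ℝ)) y) *
      ((V i : C_c(X, ℝ)) x - (V i : C_c(X, ℝ)) y)) :
    0 ≤ ∑ i, E.coreForm (U i) (V i) :=
  ge_of_tendsto' (tendsto_finsetSum _ fun i _ =>
    E.tendsto_approxForm (E.coreIncl (U i)) (E.coreIncl (V i))) fun n =>
    E.sum_approxForm_nonneg (natCast_succ_pos n) (fun i => (U i : C_c(X, ℝ)))
      (fun i => (V i : C_c(X, ℝ))) hQ0 hQ

/-- A function in `C_c` whose increments are dominated by those of finitely many elements of the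
core belongs to the core. -/
theorem mem_core_of_sq_le {ι : Type*} [Fintype ι] (v : C_c(X, ℝ)) (f : ι → E.core) {C : ℝ}
    (hC : 0 ≤ C) (h0 : ∀ x, v x ^ 2 ≤ C * ∑ i, (f i : C_c(X, ℝ)) x ^ 2)
    (h : ∀ x y, (v x - v y) ^ 2 ≤ C * ∑ i, ((f i : C_c(X, ℝ)) x - (f i : C_c(X, ℝ)) y) ^ 2) :
    v ∈ E.core := by
  refine (E.mem_domain_of_approxForm_le (v := ccToL2 μ v)
    (C := C * ∑ i, E.coreForm (f i) (f i)) fun n => ?_).1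
  -- The pairs (-v, v) and (C fᵢ, fᵢ) bound the approximating forms of v by C times those of the fᵢ,
  -- uniformly in n.
  have hpos := E.sum_approxForm_nonneg (natCast_succ_pos n)
    (fun i : Option ι => i.elim (-v) fun i => C • (f i : C_c(X, ℝ)))
    (fun i : Option ι => i.elim v fun i => (f i : C_c(X, ℝ)))
    (fun x => by
      have := h0 x
      rw [Finset.mul_sum] at this
      simp only [Fintype.sum_option, Option.elim, CompactlySupportedContinuousMap.neg_apply,
        CompactlySupportedContinuousMap.smul_apply, smul_eq_mul, mul_assoc, ← pow_two]
      linarith)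
    (fun x y => by
      have := h x y
      rw [Finset.mul_sum] at this
      simp only [Fintype.sum_option, Option.elim, CompactlySupportedContinuousMap.neg_apply,
        CompactlySupportedContinuousMap.smul_apply, smul_eq_mul, mul_assoc, ← mul_sub, ← pow_two]
      linarith)
  simp only [Fintype.sum_option, Option.elim, map_neg, map_smul] at hpos
  have h1 : ∀ u w : Lp ℝ 2 μ, E.approxForm (natCast_succ_pos n) (-u) w =
      -E.approxForm (natCast_succ_pos n) u w := fun u w => by
    simp only [approxForm, map_neg, inner_sub_left, inner_neg_left]
    ring
  have h2 : ∀ u w : Lp ℝ 2 μ, E.approxForm (natCast_succ_pos n) (C • u) w =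
      C * E.approxForm (natCast_succ_pos n) u w := fun u w => by
    simp only [approxForm, map_smul, inner_sub_left, real_inner_smul_left]
    ring
  simp only [h1, h2, ← Finset.mul_sum] at hpos
  have h3 : ∑ i, E.approxForm (natCast_succ_pos n) (ccToL2 μ (f i : C_c(X, ℝ)))
      (ccToL2 μ (f i : C_c(X, ℝ))) ≤ ∑ i, E.coreForm (f i) (f i) :=
    Finset.sum_le_sum fun i _ => E.approxForm_self_le (natCast_succ_pos n) (E.coreIncl (f i))
  have h4 := mul_le_mul_of_nonneg_left h3 hC
  linarith

/-- Lipschitz functions vanishing at the origin operate on the core. -/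
theorem mem_core_of_lipschitz {ι : Type*} [Fintype ι] (v : C_c(X, ℝ)) (f : ι → E.core)
    {F : (ι → ℝ) → ℝ} {K : NNReal} (hF : LipschitzWith K F) (hF0 : F 0 = 0)
    (hv : ∀ x, v x = F fun i => (f i : C_c(X, ℝ)) x) : v ∈ E.core := by
  have key : ∀ a b : ι → ℝ, (F a - F b) ^ 2 ≤ (K : ℝ) ^ 2 * ∑ i, (a i - b i) ^ 2 := by
    intro a b
    have h1 : |F a - F b| ≤ K * ‖a - b‖ := by
      simpa [Real.dist_eq, dist_eq_norm] using hF.dist_le_mul a b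
    have h2 : ‖a - b‖ ^ 2 ≤ ∑ i, (a i - b i) ^ 2 := by
      have hn : 0 ≤ ∑ i, (a i - b i) ^ 2 := Finset.sum_nonneg fun i _ => sq_nonneg _
      have : ‖a - b‖ ≤ Real.sqrt (∑ i, (a i - b i) ^ 2) := by
        rw [pi_norm_le_iff_of_nonneg (Real.sqrt_nonneg _)]
        intro i
        exact Real.abs_le_sqrt (Finset.single_le_sum (f := fun i => (a i - b i) ^ 2)
          (fun i _ => sq_nonneg _) (Finset.mem_univ i))
      calc ‖a - b‖ ^ 2 ≤ Real.sqrt (∑ i, (a i - b i) ^ 2) ^ 2 := by gcongr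
        _ = _ := Real.sq_sqrt hn
    calc (F a - F b) ^ 2 = |F a - F b| ^ 2 := (sq_abs _).symm
      _ ≤ (K * ‖a - b‖) ^ 2 := by gcongr
      _ = (K : ℝ) ^ 2 * ‖a - b‖ ^ 2 := by ring
      _ ≤ _ := by gcongr
  refine E.mem_core_of_sq_le v f (sq_nonneg (K : ℝ)) (fun x => ?_) fun x y => ?_
  · have := key (fun i => (f i : C_c(X, ℝ)) x) 0
    rw [hF0] at this
    simpa [hv x] using this
  · rw [hv x, hv y]
    exact key _ _

omit [MeasurableSpace X] [BorelSpace X] in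
theorem exists_abs_le (f : C_c(X, ℝ)) : ∃ M : ℝ, 0 ≤ M ∧ ∀ x, |f x| ≤ M := by
  obtain ⟨M, hM⟩ := f.continuous.bounded_above_of_compact_support f.hasCompactSupport
  exact ⟨max M 0, le_max_right _ _, fun x => (hM x).trans (le_max_left _ _)⟩

theorem mul_mem_core (f g : E.core) : (f : C_c(X, ℝ)) * (g : C_c(X, ℝ)) ∈ E.core := by
  obtain ⟨M, hM0, hM⟩ := exists_abs_le (f : C_c(X, ℝ))
  obtain ⟨N, hN0, hN⟩ := exists_abs_le (g : C_c(X, ℝ))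
  have hM2 : ∀ x, (f : C_c(X, ℝ)) x ^ 2 ≤ M ^ 2 := fun x => by
    rw [← sq_abs]
    exact pow_le_pow_left₀ (abs_nonneg _) (hM x) 2
  have hN2 : ∀ x, (g : C_c(X, ℝ)) x ^ 2 ≤ N ^ 2 := fun x => by
    rw [← sq_abs]
    exact pow_le_pow_left₀ (abs_nonneg _) (hN x) 2
  -- From ac - a'c' = a(c - c') + c'(a - a').
  have key : ∀ a a' c c' : ℝ, a ^ 2 ≤ M ^ 2 → c' ^ 2 ≤ N ^ 2 →
      (a * c - a' * c') ^ 2 ≤ 2 * (M ^ 2 + N ^ 2) * ((a - a') ^ 2 + (c - c') ^ 2) := by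
    intro a a' c c' ha hc
    have h1 : (a * c - a' * c') ^ 2 ≤ 2 * (a ^ 2 * (c - c') ^ 2) + 2 * (c' ^ 2 * (a - a') ^ 2) := by
      nlinarith [sq_nonneg (a * (c - c') - c' * (a - a'))]
    have h2 := mul_le_mul_of_nonneg_right ha (sq_nonneg (c - c'))
    have h3 := mul_le_mul_of_nonneg_right hc (sq_nonneg (a - a'))
    have h4 := mul_nonneg (sq_nonneg M) (sq_nonneg (a - a'))
    have h5 := mul_nonneg (sq_nonneg N) (sq_nonneg (c - c'))
    linarith
  refine E.mem_core_of_sq_le _ ![f, g] (C := 2 * (M ^ 2 + N ^ 2)) (by positivity)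
    (fun x => ?_) fun x y => ?_
  · have := key ((f : C_c(X, ℝ)) x) 0 ((g : C_c(X, ℝ)) x) 0 (hM2 x)
      (by simpa using sq_nonneg N)
    simpa [Fin.sum_univ_two] using this
  · have := key ((f : C_c(X, ℝ)) x) ((f : C_c(X, ℝ)) y) ((g : C_c(X, ℝ)) x) ((g : C_c(X, ℝ)) y)
      (hM2 x) (hN2 y)
    simpa [Fin.sum_univ_two] using this

/-- The product of the core. -/
def coreMul (f g : E.core) : E.core := ⟨(f : C_c(X, ℝ)) * (g : C_c(X, ℝ)), E.mul_mem_core f g⟩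

theorem coreMul_apply (f g : E.core) (x : X) :
    (E.coreMul f g : C_c(X, ℝ)) x = (f : C_c(X, ℝ)) x * (g : C_c(X, ℝ)) x := rfl

theorem coreMul_add_left (f f' g : E.core) :
    E.coreMul (f + f') g = E.coreMul f g + E.coreMul f' g := Subtype.ext (add_mul _ _ _)

theorem coreMul_smul_left (c : ℝ) (f g : E.core) :
    E.coreMul (c • f) g = c • E.coreMul f g := Subtype.ext (smul_mul_assoc _ _ _)

theorem coreMul_comm (f g : E.core) : E.coreMul f g = E.coreMul g f := Subtype.ext (mul_comm _ _)

theorem formCc_eq_coreForm (f g : E.core) :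
    E.formCc (f : C_c(X, ℝ)) (g : C_c(X, ℝ)) = E.coreForm f g := by
  rw [formCc, formL2, dif_pos ⟨f.2, g.2⟩]
  rfl

/-- The functional `f ↦ 𝓔(f g, h) + 𝓔(f h, g) - 𝓔(g h, f)` on the core. -/
def energyFunctional (g h : E.core) : E.core →ₗ[ℝ] ℝ where
  toFun f := E.coreForm (E.coreMul f g) h + E.coreForm (E.coreMul f h) g -
    E.coreForm (E.coreMul g h) f
  map_add' f f' := by
    simp only [coreMul_add_left, map_add, LinearMap.add_apply]
    ring
  map_smul' c f := by
    simp only [coreMul_smul_left, map_smul, LinearMap.smul_apply, smul_eq_mul, RingHom.id_apply]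
    ring

theorem energyFunctional_apply (g h f : E.core) : E.energyFunctional g h f =
    E.coreForm (E.coreMul f g) h + E.coreForm (E.coreMul f h) g - E.coreForm (E.coreMul g h) f :=
  rfl

theorem isEnergyMeasure_iff (g h : E.core) (ν : SignedMeasure X) :
    E.IsEnergyMeasure g h ν ↔ ∀ f : E.core,
      2 * ν.integral (fun x => (f : C_c(X, ℝ)) x) (ContinuousLinearMap.lsmul ℝ ℝ).flip =
        E.energyFunctional g h f := by
  refine forall_congr' fun f => ?_
  rw [energyFunctional_apply, ← formCc_eq_coreForm, ← formCc_eq_coreForm, ← formCc_eq_coreForm]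
  rfl

theorem energyFunctional_self_apply (g f : E.core) : E.energyFunctional g g f =
    2 * E.coreForm (E.coreMul f g) g - E.coreForm (E.coreMul g g) f := by
  rw [energyFunctional_apply]
  ring

theorem energyFunctional_comm (g h f : E.core) :
    E.energyFunctional g h f = E.energyFunctional h g f := by
  rw [energyFunctional_apply, energyFunctional_apply, E.coreMul_comm g h]
  ring

theorem energyFunctional_add_left (g g' h f : E.core) : E.energyFunctional (g + g') h f =
    E.energyFunctional g h f + E.energyFunctional g' h f := by
  rw [energyFunctional_apply, E.coreMul_comm f (g + g'), coreMul_add_left, coreMul_add_left]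
  simp only [energyFunctional_apply, map_add, LinearMap.add_apply, E.coreMul_comm g f,
    E.coreMul_comm g' f]
  ring

theorem energyFunctional_smul_left (c : ℝ) (g h f : E.core) :
    E.energyFunctional (c • g) h f = c * E.energyFunctional g h f := by
  rw [energyFunctional_apply, E.coreMul_comm f (c • g), coreMul_smul_left, coreMul_smul_left]
  simp only [energyFunctional_apply, map_smul, LinearMap.smul_apply, E.coreMul_comm g f,
    smul_eq_mul]
  ring

theorem energyFunctional_add_self (g h f : E.core) : E.energyFunctional (g + h) (g + h) f =
    E.energyFunctional g g f + 2 * E.energyFunctional g h f + E.energyFunctional h h f := by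
  rw [energyFunctional_add_left, E.energyFunctional_comm g, E.energyFunctional_comm h,
    energyFunctional_add_left, energyFunctional_add_left, E.energyFunctional_comm h g]
  ring

theorem energyFunctional_smul_self (c : ℝ) (g f : E.core) :
    E.energyFunctional (c • g) (c • g) f = c ^ 2 * E.energyFunctional g g f := by
  rw [energyFunctional_smul_left, energyFunctional_comm, energyFunctional_smul_left]
  ring

/-- For the pairs (2fg, g) and (-g², f) the increment expression equals (f(x) + f(y))(g(x) - g(y))²,
and the pointwise one equals f g². -/
theorem energyFunctional_self_nonneg (g f : E.core) (hf : ∀ x, 0 ≤ (f : C_c(X, ℝ)) x) :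
    0 ≤ E.energyFunctional g g f := by
  have h := E.sum_coreForm_nonneg ![(2 : ℝ) • E.coreMul f g, -E.coreMul g g] ![g, f]
    (fun x => by
      simp only [Fin.sum_univ_two, Matrix.cons_val_zero, Matrix.cons_val_one, Submodule.coe_neg,
        Submodule.coe_smul, CompactlySupportedContinuousMap.neg_apply,
        CompactlySupportedContinuousMap.smul_apply, smul_eq_mul, coreMul_apply]
      nlinarith [mul_nonneg (hf x) (sq_nonneg ((g : C_c(X, ℝ)) x))])
    (fun x y => by
      simp only [Fin.sum_univ_two, Matrix.cons_val_zero, Matrix.cons_val_one, Submodule.coe_neg,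
        Submodule.coe_smul, CompactlySupportedContinuousMap.neg_apply,
        CompactlySupportedContinuousMap.smul_apply, smul_eq_mul, coreMul_apply]
      nlinarith [mul_nonneg (add_nonneg (hf x) (hf y))
        (sq_nonneg ((g : C_c(X, ℝ)) x - (g : C_c(X, ℝ)) y))])
  rw [energyFunctional_self_apply]
  simp only [Fin.sum_univ_two, Matrix.cons_val_zero, Matrix.cons_val_one, coreForm_neg_left,
    coreForm_smul_left] at h
  linarith

/-- For the pairs (2Cg - 2fg, g) and (g², f) the increment expression equals (2C - f(x) - f(y))(g(x)
- g(y))², and the pointwise one (2C - f)g². -/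
theorem energyFunctional_self_le (g f : E.core) {C : ℝ} (hC : 0 ≤ C)
    (hf : ∀ x, (f : C_c(X, ℝ)) x ≤ C) :
    E.energyFunctional g g f ≤ 2 * C * E.coreForm g g := by
  have h := E.sum_coreForm_nonneg
    ![(2 * C) • g - (2 : ℝ) • E.coreMul f g, E.coreMul g g] ![g, f]
    (fun x => by
      simp only [Fin.sum_univ_two, Matrix.cons_val_zero, Matrix.cons_val_one, Submodule.coe_sub,
        Submodule.coe_smul, CompactlySupportedContinuousMap.sub_apply,
        CompactlySupportedContinuousMap.smul_apply, smul_eq_mul, coreMul_apply]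
      nlinarith [mul_nonneg (sub_nonneg.2 (hf x)) (sq_nonneg ((g : C_c(X, ℝ)) x)),
        mul_nonneg hC (sq_nonneg ((g : C_c(X, ℝ)) x))])
    (fun x y => by
      simp only [Fin.sum_univ_two, Matrix.cons_val_zero, Matrix.cons_val_one, Submodule.coe_sub,
        Submodule.coe_smul, CompactlySupportedContinuousMap.sub_apply,
        CompactlySupportedContinuousMap.smul_apply, smul_eq_mul, coreMul_apply]
      nlinarith [mul_nonneg (add_nonneg (sub_nonneg.2 (hf x)) (sub_nonneg.2 (hf y)))
        (sq_nonneg ((g : C_c(X, ℝ)) x - (g : C_c(X, ℝ)) y))])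
  rw [energyFunctional_self_apply]
  simp only [Fin.sum_univ_two, Matrix.cons_val_zero, Matrix.cons_val_one, coreForm_sub_left,
    coreForm_smul_left] at h
  linarith

/-- Here fg = g, so the claim is 𝓔(g², f) ≤ 𝓔(g, g); the pairs are (g, g) and (-g², f). It bounds
Γ(g)(X) below by 𝓔(g)/2 and makes the normalization meaningful. -/
theorem coreForm_self_le_energyFunctional (g f : E.core) (h0 : ∀ x, 0 ≤ (f : C_c(X, ℝ)) x)
    (h1 : ∀ x, (f : C_c(X, ℝ)) x ≤ 1)
    (hfg : ∀ x, (g : C_c(X, ℝ)) x ≠ 0 → (f : C_c(X, ℝ)) x = 1) :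
    E.coreForm g g ≤ E.energyFunctional g g f := by
  have hmul : E.coreMul f g = g := by
    refine Subtype.ext (CompactlySupportedContinuousMap.ext fun x => ?_)
    rw [coreMul_apply]
    by_cases hx : (g : C_c(X, ℝ)) x = 0
    · simp [hx]
    · simp [hfg x hx]
  have h := E.sum_coreForm_nonneg ![g, -E.coreMul g g] ![g, f]
    (fun x => by
      simp only [Fin.sum_univ_two, Matrix.cons_val_zero, Matrix.cons_val_one, Submodule.coe_neg,
        CompactlySupportedContinuousMap.neg_apply, coreMul_apply]
      nlinarith [mul_nonneg (sub_nonneg.2 (h1 x)) (sq_nonneg ((g : C_c(X, ℝ)) x))])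
    (fun x y => by
      simp only [Fin.sum_univ_two, Matrix.cons_val_zero, Matrix.cons_val_one, Submodule.coe_neg,
        CompactlySupportedContinuousMap.neg_apply, coreMul_apply]
      by_cases hx : (g : C_c(X, ℝ)) x = 0
      · by_cases hy : (g : C_c(X, ℝ)) y = 0
        · simp [hx, hy]
        · rw [hx, hfg y hy]
          nlinarith [mul_nonneg (h0 x) (sq_nonneg ((g : C_c(X, ℝ)) y))]
      · by_cases hy : (g : C_c(X, ℝ)) y = 0
        · rw [hy, hfg x hx]
          nlinarith [mul_nonneg (h0 y) (sq_nonneg ((g : C_c(X, ℝ)) x))]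
        · rw [hfg x hx, hfg y hy]
          nlinarith [sq_nonneg ((g : C_c(X, ℝ)) x - (g : C_c(X, ℝ)) y)])
  rw [energyFunctional_self_apply, hmul]
  simp only [Fin.sum_univ_two, Matrix.cons_val_zero, Matrix.cons_val_one, coreForm_neg_left] at h
  linarith

end CoreAlgebra

end SymmDirichletForm

namespace SymmDirichletForm

/-! ### Existence, uniqueness and quadratic structure of energy measures -/

section EnergyMeasure

open scoped ZeroAtInfty

variable {X : Type*} [TopologicalSpace X] [MeasurableSpace X] [BorelSpace X]
  {μ : Measure X} [IsFiniteMeasureOnCompacts μ] {E : SymmDirichletForm μ}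

theorem sup_zero_mem_core (f : E.core) : (f : C_c(X, ℝ)) ⊔ 0 ∈ E.core :=
  E.mem_core_of_lipschitz _ (fun _ : Unit => f) (F := fun a => max (a ()) 0) (K := 1)
    ((LipschitzWith.eval ()).max_const 0) (by simp) fun _ => rfl

theorem IsRegular.exists_nonneg_approx (hreg : E.IsRegular) (h : C_c(X, ℝ)) (hh : ∀ x, 0 ≤ h x)
    {ε : ℝ} (hε : 0 < ε) :
    ∃ f : E.core, (∀ x, 0 ≤ (f : C_c(X, ℝ)) x) ∧ ∀ x, |h x - (f : C_c(X, ℝ)) x| < ε := by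
  obtain ⟨f, hf⟩ := hreg.2 h ε hε
  refine ⟨⟨_, sup_zero_mem_core f⟩, fun x => le_max_right _ _, fun x => ?_⟩
  refine lt_of_le_of_lt ?_ (hf x)
  have : h x = max (h x) 0 := (max_eq_left (hh x)).symm
  change |h x - max ((f : C_c(X, ℝ)) x) 0| ≤ _
  nth_rewrite 1 [this]
  exact (abs_max_sub_max_le_max _ _ _ _).trans (by simp)

theorem IsRegular.exists_cutoff [LocallyCompactSpace X] [T2Space X] (hreg : E.IsRegular)
    {K : Set X} (hK : IsCompact K) :
    ∃ f : E.core, (∀ x, 0 ≤ (f : C_c(X, ℝ)) x) ∧ (∀ x, (f : C_c(X, ℝ)) x ≤ 1) ∧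
      ∀ x ∈ K, (f : C_c(X, ℝ)) x = 1 := by
  obtain ⟨h, h1, -, hc, h01⟩ := exists_continuous_one_zero_of_isCompact hK isClosed_empty
    (Set.disjoint_empty _)
  -- Approximating twice the Urysohn function within 1 gives values above 1 on K, which clamping to
  -- [0, 1] turns into exactly 1.
  obtain ⟨f, hf⟩ := hreg.2 ((2 : ℝ) • ⟨h, hc⟩) 1 one_pos
  have hcont : Continuous fun t : ℝ => min (max t 0) 1 := by fun_prop
  set v : C_c(X, ℝ) := (f : C_c(X, ℝ)).compLeft ⟨fun t : ℝ => min (max t 0) 1, hcont⟩ with hv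
  have hvx : ∀ x, v x = min (max ((f : C_c(X, ℝ)) x) 0) 1 := fun x =>
    CompactlySupportedContinuousMap.compLeft_apply (by simp) _ _
  have hmem : v ∈ E.core :=
    E.mem_core_of_lipschitz _ (fun _ : Unit => f) (F := fun a => min (max (a ()) 0) 1) (K := 1)
      (((LipschitzWith.eval ()).max_const 0).min_const 1) (by simp) hvx
  refine ⟨⟨v, hmem⟩, fun x => ?_, fun x => ?_, fun x hx => ?_⟩
  · rw [hvx]
    exact le_min (le_max_right _ _) zero_le_one
  · rw [hvx]
    exact min_le_right _ _
  · have h2 := hf x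
    have h3 : ((2 : ℝ) • (⟨h, hc⟩ : C_c(X, ℝ))) x = 2 := by
      change (2 : ℝ) * h x = 2
      rw [h1 hx]
      simp
    rw [h3, abs_lt] at h2
    rw [hvx]
    exact min_eq_right (le_max_of_le_left (by linarith))

/-- The inclusion of the core in the functions vanishing at infinity. -/
def coreToZeroAtInfty (E : SymmDirichletForm μ) : E.core →ₗ[ℝ] C₀(X, ℝ) where
  toFun f := ((f : C_c(X, ℝ)) : C₀(X, ℝ))
  map_add' _ _ := rfl
  map_smul' _ _ := rfl

theorem coreToZeroAtInfty_injective : Function.Injective E.coreToZeroAtInfty := fun _ _ h =>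
  Subtype.ext (CompactlySupportedContinuousMap.ext fun x => DFunLike.congr_fun h x)

omit [MeasurableSpace X] [BorelSpace X] in
theorem norm_zeroAtInfty_le {f : C₀(X, ℝ)} {M : ℝ} (hM : 0 ≤ M) (h : ∀ x, |f x| ≤ M) : ‖f‖ ≤ M := by
  rw [← ZeroAtInftyContinuousMap.norm_toBCF_eq_norm]
  exact (BoundedContinuousFunction.norm_le hM).2 h

omit [MeasurableSpace X] [BorelSpace X] in
theorem abs_apply_le_norm (f : C₀(X, ℝ)) (x : X) : |f x| ≤ ‖f‖ := by
  rw [← ZeroAtInftyContinuousMap.norm_toBCF_eq_norm]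
  exact f.toBCF.norm_coe_le_norm x

/-- A uniformly bounded functional on the core extends to `C₀(X)`. -/
theorem exists_extension_zeroAtInfty (Φ : E.core →ₗ[ℝ] ℝ) {C : ℝ} (hC0 : 0 ≤ C)
    (hC : ∀ (f : E.core) (M : ℝ), 0 ≤ M → (∀ x, (f : C_c(X, ℝ)) x ≤ M) → Φ f ≤ C * M) :
    ∃ G : C₀(X, ℝ) →L[ℝ] ℝ, ‖G‖ ≤ C ∧ ∀ f : E.core, G (E.coreToZeroAtInfty f) = Φ f := by
  have habs : ∀ f : E.core, |Φ f| ≤ C * ‖E.coreToZeroAtInfty f‖ := by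
    intro f
    have hb : ∀ x, |(f : C_c(X, ℝ)) x| ≤ ‖E.coreToZeroAtInfty f‖ := fun x =>
      abs_apply_le_norm (E.coreToZeroAtInfty f) x
    rw [abs_le']
    refine ⟨hC f _ (norm_nonneg _) fun x => (le_abs_self _).trans (hb x), ?_⟩
    have := hC ((-1 : ℝ) • f) _ (norm_nonneg (E.coreToZeroAtInfty f)) fun x => by
      change -1 * (f : C_c(X, ℝ)) x ≤ _
      rw [neg_one_mul]
      exact (neg_le_abs _).trans (hb x)
    rwa [map_smul, smul_eq_mul, neg_one_mul] at this
  set e := LinearEquiv.ofInjective E.coreToZeroAtInfty coreToZeroAtInfty_injective with he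
  have hbd : ∀ y, ‖(Φ.comp e.symm.toLinearMap) y‖ ≤ C * ‖y‖ := by
    intro y
    obtain ⟨f, rfl⟩ := e.surjective y
    simpa using! habs f
  obtain ⟨G, hG1, hG2⟩ := exists_extension_norm_eq (LinearMap.range E.coreToZeroAtInfty)
    ((Φ.comp e.symm.toLinearMap).mkContinuous C hbd)
  refine ⟨G, hG2.le.trans (LinearMap.mkContinuous_norm_le _ hC0 _), fun f => ?_⟩
  have := hG1 (e f)
  simpa using! this

/-- A positive, uniformly bounded functional on the core of a regular form is given by a finite
measure. -/
theorem IsRegular.exists_measure [LocallyCompactSpace X] [T2Space X] (hreg : E.IsRegular)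
    (Φ : E.core →ₗ[ℝ] ℝ) {C : ℝ} (hC0 : 0 ≤ C)
    (hpos : ∀ f : E.core, (∀ x, 0 ≤ (f : C_c(X, ℝ)) x) → 0 ≤ Φ f)
    (hC : ∀ (f : E.core) (M : ℝ), 0 ≤ M → (∀ x, (f : C_c(X, ℝ)) x ≤ M) → Φ f ≤ C * M) :
    ∃ ν : Measure X, ν Set.univ ≤ ENNReal.ofReal C ∧
      ∀ f : E.core, ∫ x, (f : C_c(X, ℝ)) x ∂ν = Φ f := by
  obtain ⟨G, hG1, hG2⟩ := exists_extension_zeroAtInfty Φ hC0 hC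
  set Λ₀ : C_c(X, ℝ) →ₗ[ℝ] ℝ :=
    { toFun := fun h => G (h : C₀(X, ℝ))
      map_add' := fun h h' => G.map_add (h : C₀(X, ℝ)) (h' : C₀(X, ℝ))
      map_smul' := fun c h => G.map_smul c (h : C₀(X, ℝ)) } with hΛ₀
  -- Positivity is known on the core only; it transfers through nonnegative core functions uniformly
  -- close to h. The denominator C + 1 avoids dividing by C = 0.
  have hΛpos : ∀ h : C_c(X, ℝ), 0 ≤ h → 0 ≤ Λ₀ h := by
    intro h hh
    refine le_of_forall_pos_le_add fun ε hε => ?_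
    have hC1 : 0 < C + 1 := by linarith
    obtain ⟨f, hf0, hf⟩ := hreg.exists_nonneg_approx h hh (div_pos hε hC1)
    have h1 : ‖(h : C₀(X, ℝ)) - E.coreToZeroAtInfty f‖ ≤ ε / (C + 1) :=
      norm_zeroAtInfty_le (by positivity) fun x => (hf x).le
    have h2 := (G.le_opNorm ((h : C₀(X, ℝ)) - E.coreToZeroAtInfty f)).trans
      (mul_le_mul hG1 h1 (norm_nonneg _) hC0)
    have h3 : C * (ε / (C + 1)) ≤ ε := by
      rw [mul_div_assoc', div_le_iff₀ hC1]
      nlinarith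
    rw [map_sub, hG2, Real.norm_eq_abs] at h2
    have h4 := (abs_le.1 (h2.trans h3)).1
    have h5 := hpos f hf0
    change 0 ≤ G (h : C₀(X, ℝ)) + ε
    linarith
  set Λ : C_c(X, ℝ) →ₚ[ℝ] ℝ := PositiveLinearMap.mk₀ Λ₀ hΛpos with hΛ
  refine ⟨RealRMK.rieszMeasure Λ, ?_, fun f => ?_⟩
  -- Inner regularity reduces the total mass to compact sets, where a Urysohn function of norm at
  -- most 1 tests it against ‖G‖ ≤ C.
  · rw [isOpen_univ.measure_eq_iSup_isCompact]
    refine iSup₂_le fun K _ => iSup_le fun hK => ?_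
    obtain ⟨h, h1, -, hc, h01⟩ := exists_continuous_one_zero_of_isCompact hK isClosed_empty
      (Set.disjoint_empty _)
    refine (RealRMK.rieszMeasure_le_of_eq_one Λ (f := ⟨h, hc⟩) (fun x => (h01 x).1) hK
      fun x hx => h1 hx).trans (ENNReal.ofReal_le_ofReal ?_)
    have h2 := G.le_opNorm ((⟨h, hc⟩ : C_c(X, ℝ)) : C₀(X, ℝ))
    have h3 : ‖((⟨h, hc⟩ : C_c(X, ℝ)) : C₀(X, ℝ))‖ ≤ 1 :=
      norm_zeroAtInfty_le zero_le_one fun x => abs_le.2 ⟨by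
        have := (h01 x).1
        change -1 ≤ h x
        linarith, (h01 x).2⟩
    change G ((⟨h, hc⟩ : C_c(X, ℝ)) : C₀(X, ℝ)) ≤ C
    calc _ ≤ _ := (le_abs_self _).trans h2
      _ ≤ C * 1 := mul_le_mul hG1 h3 (norm_nonneg _) hC0
      _ = C := mul_one C
  · rw [RealRMK.integral_rieszMeasure]
    exact hG2 f

variable [LocallyCompactSpace X] [SecondCountableTopology X] [T2Space X]

/-- Finite measures are determined by their integrals against the core of a regular form. -/
theorem IsRegular.measure_ext (hreg : E.IsRegular) {ν ν' : Measure X} [IsFiniteMeasure ν]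
    [IsFiniteMeasure ν']
    (h : ∀ f : E.core, ∫ x, (f : C_c(X, ℝ)) x ∂ν = ∫ x, (f : C_c(X, ℝ)) x ∂ν') : ν = ν' := by
  have : TopologicalSpace.MetrizableSpace X :=
    TopologicalSpace.metrizableSpace_of_t3_secondCountable X
  have hint : ∀ (ρ : Measure X) [IsFiniteMeasure ρ] (g : C_c(X, ℝ)), Integrable g ρ :=
    fun ρ _ g => g.continuous.integrable_of_hasCompactSupport g.hasCompactSupport
  have happrox : ∀ (ρ : Measure X) [IsFiniteMeasure ρ] (g f : C_c(X, ℝ)) (ε : ℝ),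
      (∀ x, |g x - f x| < ε) → |∫ x, g x ∂ρ - ∫ x, f x ∂ρ| ≤ ε * ρ.real Set.univ := by
    intro ρ _ g f ε hgf
    rw [← integral_sub (hint ρ g) (hint ρ f)]
    exact norm_integral_le_of_norm_le_const (f := fun x => g x - f x)
      (ae_of_all _ fun x => (hgf x).le)
  refine Measure.ext_of_integral_eq_on_compactlySupported fun g => ?_
  rw [← sub_eq_zero, ← abs_eq_zero]
  refine le_antisymm (le_of_forall_pos_le_add fun ε hε => ?_) (abs_nonneg _)
  set c := ν.real Set.univ + ν'.real Set.univ + 1 with hc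
  have hc0 : 0 < c := by positivity
  obtain ⟨f, hf⟩ := hreg.2 g (ε / c) (div_pos hε hc0)
  have h1 := abs_le.1 (happrox ν g f _ hf)
  have h2 := abs_le.1 (happrox ν' g f _ hf)
  have h3 := h f
  have h4 : ε / c * ν.real Set.univ + ε / c * ν'.real Set.univ ≤ ε := by
    rw [← mul_add, div_mul_eq_mul_div, div_le_iff₀ hc0]
    nlinarith
  rw [zero_add, abs_le]
  constructor <;> linarith [h1.1, h1.2, h2.1, h2.2]

omit [SecondCountableTopology X] in
theorem IsRegular.exists_energyMeasure (hreg : E.IsRegular) (g : E.core) :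
    ∃ ν : Measure X, ν Set.univ ≤ ENNReal.ofReal (E.coreForm g g) ∧
      ∀ f : E.core, 2 * ∫ x, (f : C_c(X, ℝ)) x ∂ν = E.energyFunctional g g f := by
  obtain ⟨ν, h1, h2⟩ := hreg.exists_measure ((2 : ℝ)⁻¹ • E.energyFunctional g g)
    (E.coreForm_self_nonneg g)
    (fun f hf => by
      have := E.energyFunctional_self_nonneg g f hf
      simp only [LinearMap.smul_apply, smul_eq_mul]
      positivity)
    (fun f M hM hf => by
      have := E.energyFunctional_self_le g f hM hf
      simp only [LinearMap.smul_apply, smul_eq_mul]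
      linarith)
  refine ⟨ν, h1, fun f => ?_⟩
  rw [h2]
  simp

omit [LocallyCompactSpace X] [SecondCountableTopology X] [T2Space X] in
theorem isEnergyMeasure_toSignedMeasure_iff {g h : E.core} {ν : Measure X} [IsFiniteMeasure ν] :
    E.IsEnergyMeasure g h ν.toSignedMeasure ↔
      ∀ f : E.core, 2 * ∫ x, (f : C_c(X, ℝ)) x ∂ν = E.energyFunctional g h f := by
  rw [isEnergyMeasure_iff]
  simp only [VectorMeasure.integral_toSignedMeasure]

omit [SecondCountableTopology X] in
theorem IsRegular.energyMeasure_spec (hreg : E.IsRegular) (g : E.core) :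
    ∃ _ : IsFiniteMeasure (E.energyMeasure g),
      E.IsEnergyMeasure g g (E.energyMeasure g).toSignedMeasure := by
  have h : ∃ (ν : Measure X) (_ : IsFiniteMeasure ν), E.IsEnergyMeasure g g ν.toSignedMeasure := by
    obtain ⟨ν, h1, h2⟩ := hreg.exists_energyMeasure g
    have : IsFiniteMeasure ν := ⟨h1.trans_lt ENNReal.ofReal_lt_top⟩
    exact ⟨ν, this, isEnergyMeasure_toSignedMeasure_iff.2 h2⟩
  rw [energyMeasure, dif_pos h]
  exact h.choose_spec

omit [SecondCountableTopology X] in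
theorem IsRegular.isFiniteMeasure_energyMeasure (hreg : E.IsRegular) (g : E.core) :
    IsFiniteMeasure (E.energyMeasure g) := (hreg.energyMeasure_spec g).choose

omit [SecondCountableTopology X] in
theorem IsRegular.integral_energyMeasure (hreg : E.IsRegular) (g f : E.core) :
    2 * ∫ x, (f : C_c(X, ℝ)) x ∂(E.energyMeasure g) = E.energyFunctional g g f := by
  obtain ⟨h1, h2⟩ := hreg.energyMeasure_spec g
  exact isEnergyMeasure_toSignedMeasure_iff.1 h2 f

/-- The defining choice carries no mass bound; uniqueness identifies the chosen measure with the
Riesz measure, which has one. -/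
theorem IsRegular.energyMeasure_univ_le (hreg : E.IsRegular) (g : E.core) :
    E.energyMeasure g Set.univ ≤ ENNReal.ofReal (E.coreForm g g) := by
  obtain ⟨ν, h1, h2⟩ := hreg.exists_energyMeasure g
  have : IsFiniteMeasure ν := ⟨h1.trans_lt ENNReal.ofReal_lt_top⟩
  have := hreg.isFiniteMeasure_energyMeasure g
  have : E.energyMeasure g = ν := hreg.measure_ext fun f => by
    have h3 := h2 f
    have h4 := hreg.integral_energyMeasure g f
    linarith
  rwa [this]

omit [SecondCountableTopology X] in
theorem IsRegular.energyMeasure_univ_pos (hreg : E.IsRegular) {g : E.core}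
    (hg : 0 < E.coreForm g g) : 0 < E.energyMeasure g Set.univ := by
  obtain ⟨f, h0, h1, hf⟩ := hreg.exists_cutoff (g : C_c(X, ℝ)).hasCompactSupport
  have h2 := E.coreForm_self_le_energyFunctional g f h0 h1
    fun x hx => hf x (subset_tsupport _ hx)
  rw [← hreg.integral_energyMeasure] at h2
  rw [pos_iff_ne_zero, Ne, Measure.measure_univ_eq_zero]
  intro h3
  rw [h3, integral_zero_measure] at h2
  linarith

theorem IsRegular.energyMeasure_smul (hreg : E.IsRegular) (c : ℝ) (g : E.core) :
    E.energyMeasure (c • g) = ENNReal.ofReal (c ^ 2) • E.energyMeasure g := by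
  have := hreg.isFiniteMeasure_energyMeasure g
  have := hreg.isFiniteMeasure_energyMeasure (c • g)
  have : IsFiniteMeasure (ENNReal.ofReal (c ^ 2) • E.energyMeasure g) :=
    Measure.smul_finite _ ENNReal.ofReal_ne_top
  refine hreg.measure_ext fun f => ?_
  have h1 := hreg.integral_energyMeasure g f
  have h2 := hreg.integral_energyMeasure (c • g) f
  rw [energyFunctional_smul_self, ← h1] at h2
  rw [integral_smul_measure, ENNReal.toReal_ofReal (sq_nonneg c), smul_eq_mul]
  linarith

theorem IsRegular.energyMeasure_parallelogram (hreg : E.IsRegular) (g h : E.core) :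
    E.energyMeasure (g + h) + E.energyMeasure (g - h) =
      (2 : ℝ≥0∞) • E.energyMeasure g + (2 : ℝ≥0∞) • E.energyMeasure h := by
  have := fun g => hreg.isFiniteMeasure_energyMeasure g
  have : ∀ g, IsFiniteMeasure ((2 : ℝ≥0∞) • E.energyMeasure g) := fun g =>
    Measure.smul_finite _ ENNReal.ofNat_ne_top
  refine hreg.measure_ext fun f => ?_
  have hint : ∀ (ρ : Measure X) [IsFiniteMeasure ρ], Integrable (f : C_c(X, ℝ)) ρ :=
    fun ρ _ => (f : C_c(X, ℝ)).continuous.integrable_of_hasCompactSupport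
      (f : C_c(X, ℝ)).hasCompactSupport
  rw [integral_add_measure (hint _) (hint _), integral_add_measure (hint _) (hint _),
    integral_smul_measure, integral_smul_measure]
  have h1 := hreg.integral_energyMeasure (g + h) f
  -- Writing g - h as g + (-1)h lets the expansion of the quadratic form and its homogeneity apply.
  have h2 := hreg.integral_energyMeasure (g + (-1 : ℝ) • h) f
  have h3 := hreg.integral_energyMeasure g f
  have h4 := hreg.integral_energyMeasure h f
  have h5 : g + (-1 : ℝ) • h = g - h := by module
  rw [energyFunctional_add_self] at h1 h2
  rw [energyFunctional_smul_self, E.energyFunctional_comm g (_ • h), energyFunctional_smul_left,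
    E.energyFunctional_comm h g, h5] at h2
  simp only [ENNReal.toReal_ofNat, smul_eq_mul]
  linarith

/-- Drops the nonnegative measure Γ(g - h) from the parallelogram identity; this takes the place of
a Cauchy–Schwarz inequality for mutual energy measures. -/
theorem IsRegular.energyMeasure_add_le (hreg : E.IsRegular) (g h : E.core) :
    E.energyMeasure (g + h) ≤
      (2 : ℝ≥0∞) • E.energyMeasure g + (2 : ℝ≥0∞) • E.energyMeasure h := by
  rw [← hreg.energyMeasure_parallelogram]
  exact Measure.le_add_right le_rfl

end EnergyMeasure

end SymmDirichletForm

/-! ### Radon–Nikodym densities and a truncated linear function -/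

section Density

variable {X : Type*} [MeasurableSpace X]

theorem exists_withDensityᵥ_eq {m ν : Measure X} [IsFiniteMeasure m] [IsFiniteMeasure ν]
    (h : ν ≪ m) : ∃ ρ : X → ℝ, MemLp ρ 1 m ∧ m.withDensityᵥ ρ = ν.toSignedMeasure := by
  refine ⟨fun x => (ν.rnDeriv m x).toReal, ?_, ?_⟩
  · exact memLp_one_iff_integrable.2 Measure.integrable_toReal_rnDeriv
  · rw [withDensityᵥ_toReal (Measure.measurable_rnDeriv ν m).aemeasurable
      (Measure.lintegral_rnDeriv_lt_top ν m).ne]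
    exact Measure.toSignedMeasure_congr (Measure.withDensity_rnDeriv_eq ν m h)

theorem exists_bounded_withDensityᵥ_eq {m ν : Measure X} [IsFiniteMeasure m] [IsFiniteMeasure ν]
    {c : ℝ≥0∞} (hc : c ≠ ∞) (h : ν ≤ c • m) :
    ∃ ρ : X → ℝ, MemLp ρ 1 m ∧ MemLp ρ ∞ m ∧ m.withDensityᵥ ρ = ν.toSignedMeasure := by
  have hac : ν ≪ m := Measure.absolutelyContinuous_of_le_smul h
  have hle : ∀ᵐ x ∂m, ν.rnDeriv m x ≤ c := by
    refine ae_le_of_forall_setLIntegral_le_of_sigmaFinite (Measure.measurable_rnDeriv ν m)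
      fun s _ _ => ?_
    rw [setLIntegral_const]
    exact (Measure.setLIntegral_rnDeriv_le s).trans (h s)
  refine ⟨fun x => (ν.rnDeriv m x).toReal, ?_, ?_, ?_⟩
  · exact memLp_one_iff_integrable.2 Measure.integrable_toReal_rnDeriv
  · refine memLp_top_of_bound (Measure.measurable_rnDeriv ν m).ennreal_toReal.aestronglyMeasurable
      c.toReal ?_
    filter_upwards [hle] with x hx
    rw [Real.norm_of_nonneg ENNReal.toReal_nonneg]
    exact ENNReal.toReal_mono hc hx
  · rw [withDensityᵥ_toReal (Measure.measurable_rnDeriv ν m).aemeasurable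
      (Measure.lintegral_rnDeriv_lt_top ν m).ne]
    exact Measure.toSignedMeasure_congr (Measure.withDensity_rnDeriv_eq ν m hac)

end Density

/-- On bounded sets, the multiple of a coordinate is given by a function in `C_b¹`. -/
theorem exists_contDiff_eq_const_mul_of_abs_le (c : ℝ) {R : ℝ} (hR : 0 ≤ R) :
    ∃ F : (Fin 1 → ℝ) → ℝ, ContDiff ℝ 1 F ∧ (∃ M : ℝ, ∀ y, |F y| ≤ M ∧ ‖fderiv ℝ F y‖ ≤ M) ∧
      F 0 = 0 ∧ ∀ t : ℝ, |t| ≤ R → F (fun _ => t) = c * t := by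
  -- The inner radius R + 1 stays positive when R = 0.
  let χ : ContDiffBump (0 : Fin 1 → ℝ) := ⟨R + 1, R + 2, by linarith, by linarith⟩
  set F : (Fin 1 → ℝ) → ℝ := fun y => c * y 0 * χ y with hF
  have hcd : ContDiff ℝ 1 F := (contDiff_const.mul (contDiff_apply ℝ ℝ 0)).mul χ.contDiff
  have hcs : HasCompactSupport F := χ.hasCompactSupport.mul_left
  obtain ⟨M₁, hM₁⟩ := hcd.continuous.bounded_above_of_compact_support hcs
  obtain ⟨M₂, hM₂⟩ := (hcd.continuous_fderiv one_ne_zero).bounded_above_of_compact_support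
    (hcs.fderiv ℝ)
  refine ⟨F, hcd, ⟨max M₁ M₂, fun y => ⟨(hM₁ y).trans (le_max_left _ _),
    (hM₂ y).trans (le_max_right _ _)⟩⟩, by simp [hF], fun t ht => ?_⟩
  have h1 : χ (fun _ => t) = 1 := by
    refine χ.one_of_mem_closedBall ?_
    rw [mem_closedBall_zero_iff, pi_norm_le_iff_of_nonneg (by change (0 : ℝ) ≤ R + 1; linarith)]
    intro _
    change |t| ≤ R + 1
    linarith
  simp [hF, h1]

namespace SymmDirichletForm

/-! ### Cylinder functions, domination and normalization -/

section Coordinates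

variable {X : Type*} [TopologicalSpace X] [MeasurableSpace X] [BorelSpace X]
  {μ : Measure X} [IsFiniteMeasureOnCompacts μ] {E : SymmDirichletForm μ}

/-- A bounded derivative makes F Lipschitz, and F(0) = 0 confines the support to the union of the
supports of the coordinates; Lipschitz functions operate on the core. -/
theorem IsCylinder.exists_core [R1Space X] {I : Type*} {φ : I → E.core} {f : X → ℝ}
    (hf : E.IsCylinder φ f) : ∃ g : E.core, ∀ x, (g : C_c(X, ℝ)) x = f x := by
  obtain ⟨k, i, F, hF, ⟨M, hM⟩, hF0, hfF⟩ := hf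
  have hM0 : 0 ≤ M := (abs_nonneg _).trans (hM 0).1
  have hlip : LipschitzWith M.toNNReal F :=
    lipschitzWith_of_nnnorm_fderiv_le (hF.differentiable one_ne_zero) fun y => by
      rw [← NNReal.coe_le_coe, coe_nnnorm, Real.coe_toNNReal M hM0]
      exact (hM y).2
  have hcont : Continuous f := by
    rw [funext hfF]
    exact hF.continuous.comp (continuous_pi fun j => (φ (i j) : C_c(X, ℝ)).continuous)
  have hsupp : HasCompactSupport f := by
    refine HasCompactSupport.intro
      (isCompact_iUnion fun j : Fin k => (φ (i j) : C_c(X, ℝ)).hasCompactSupport) fun x hx => ?_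
    rw [hfF, ← hF0]
    congr 1
    funext j
    exact image_eq_zero_of_notMem_tsupport fun hj => hx (Set.mem_iUnion.2 ⟨j, hj⟩)
  exact ⟨⟨⟨⟨f, hcont⟩, hsupp⟩, E.mem_core_of_lipschitz _ (fun j => φ (i j)) hlip hF0 hfF⟩,
    fun _ => rfl⟩

/-- A multiple of a coordinate is a cylinder function. -/
theorem isCylinder_smul {I : Type*} (φ : I → E.core) (i : I) (c : ℝ) :
    E.IsCylinder φ ((c • φ i : E.core) : C_c(X, ℝ)) := by
  obtain ⟨R, hR, hb⟩ := exists_abs_le (φ i : C_c(X, ℝ))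
  obtain ⟨F, h1, h2, h3, h4⟩ := exists_contDiff_eq_const_mul_of_abs_le c hR
  exact ⟨1, fun _ => i, F, h1, h2, h3, fun x => (h4 _ (hb x)).symm⟩

theorem energyMeasure_le_weightedEnergySum (f : ℕ → E.core) (n : ℕ) :
    E.energyMeasure (f n) ≤ (2 : ℝ≥0∞) ^ n • E.weightedEnergySum f := by
  have h := Measure.le_sum (fun n => ((2 : ℝ≥0∞)⁻¹ ^ n) • E.energyMeasure (f n)) n
  have h2 : E.energyMeasure (f n) =
      (2 : ℝ≥0∞) ^ n • (((2 : ℝ≥0∞)⁻¹ ^ n) • E.energyMeasure (f n)) := by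
    rw [smul_smul, ← mul_pow, ENNReal.mul_inv_cancel two_ne_zero ENNReal.ofNat_ne_top, one_pow,
      one_smul]
  rw [h2]
  gcongr
  exact h

theorem isFiniteMeasure_weightedEnergySum {f : ℕ → E.core}
    (hf : ∀ n, E.energyMeasure (f n) Set.univ = 1) : IsFiniteMeasure (E.weightedEnergySum f) := by
  constructor
  rw [weightedEnergySum, Measure.sum_apply _ MeasurableSet.univ]
  simp only [Measure.smul_apply, hf, smul_eq_mul, mul_one, ENNReal.tsum_geometric]
  rw [ENNReal.inv_lt_top, tsub_pos_iff_lt]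
  exact ENNReal.inv_lt_one.2 ENNReal.one_lt_two

variable [LocallyCompactSpace X] [SecondCountableTopology X] [T2Space X]

/-- If the energy measures of `g`, `h` and `g + h` have densities, then so does the mutual energy
measure. -/
theorem IsRegular.isEnergyMeasure_polarization (hreg : E.IsRegular) (g h : E.core) {m : Measure X}
    {ρ ρ₁ ρ₂ : X → ℝ} (hρ : Integrable ρ m) (hρ₁ : Integrable ρ₁ m) (hρ₂ : Integrable ρ₂ m)
    [IsFiniteMeasure (E.energyMeasure (g + h))] [IsFiniteMeasure (E.energyMeasure g)]
    [IsFiniteMeasure (E.energyMeasure h)]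
    (e : m.withDensityᵥ ρ = (E.energyMeasure (g + h)).toSignedMeasure)
    (e₁ : m.withDensityᵥ ρ₁ = (E.energyMeasure g).toSignedMeasure)
    (e₂ : m.withDensityᵥ ρ₂ = (E.energyMeasure h).toSignedMeasure) :
    E.IsEnergyMeasure g h (m.withDensityᵥ ((2 : ℝ)⁻¹ • (ρ - ρ₁ - ρ₂))) := by
  rw [isEnergyMeasure_iff, withDensityᵥ_smul, withDensityᵥ_sub (hρ.sub hρ₁) hρ₂,
    withDensityᵥ_sub hρ hρ₁, e, e₁, e₂]
  intro f
  have hint : ∀ (ν : Measure X) [IsFiniteMeasure ν],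
      ν.toSignedMeasure.Integrable (f : C_c(X, ℝ)) := fun ν _ => by
    rw [VectorMeasure.Integrable, Measure.variation_toSignedMeasure]
    exact (f : C_c(X, ℝ)).continuous.integrable_of_hasCompactSupport
      (f : C_c(X, ℝ)).hasCompactSupport
  rw [VectorMeasure.integral_smul_vectorMeasure,
    VectorMeasure.integral_sub_vectorMeasure ((hint _).sub_vectorMeasure (hint _)) (hint _),
    VectorMeasure.integral_sub_vectorMeasure (hint _) (hint _),
    VectorMeasure.integral_toSignedMeasure, VectorMeasure.integral_toSignedMeasure,
    VectorMeasure.integral_toSignedMeasure]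
  have h1 := hreg.integral_energyMeasure (g + h) f
  have h2 := hreg.integral_energyMeasure g f
  have h3 := hreg.integral_energyMeasure h f
  rw [energyFunctional_add_self] at h1
  rw [smul_eq_mul]
  linarith

omit [LocallyCompactSpace X] [SecondCountableTopology X] [T2Space X] in
theorem coreIncl_sub (g h : E.core) : E.coreIncl (g - h) = E.coreIncl g - E.coreIncl h :=
  rfl

/-- On an m-null set A the splitting g = (g - ψₙ) + ψₙ leaves Γ(g)(A) ≤ 2Γ(g - ψₙ)(A) ≤ 2𝓔(g - ψₙ),
and ψₙ can be chosen to make this at most ε. -/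
theorem IsRegular.absolutelyContinuous_energyMeasure (hreg : E.IsRegular) {ψ : ℕ → E.core}
    (hψ : ∀ (u : E.domain) (ε : ℝ), 0 < ε → ∃ n, E.energyOne (u - E.coreIncl (ψ n)) < ε)
    {m : Measure X} (hm : ∀ n, E.energyMeasure (ψ n) ≪ m) (g : E.core) :
    E.energyMeasure g ≪ m := by
  intro A hA
  refine le_antisymm (ENNReal.le_of_forall_pos_le_add fun ε hε _ => ?_) zero_le
  obtain ⟨n, hn⟩ := hψ (E.coreIncl g) (ε / 2) (by positivity)
  have h1 := hreg.energyMeasure_add_le (g - ψ n) (ψ n) A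
  rw [show g - ψ n + ψ n = g by module] at h1
  have h2 : E.coreForm (g - ψ n) (g - ψ n) ≤ ε / 2 := by
    refine le_trans ?_ hn.le
    rw [energyOne, coreForm_apply, coreIncl_sub]
    exact le_add_of_nonneg_right (sq_nonneg _)
  have h3 : E.energyMeasure (g - ψ n) A ≤ ENNReal.ofReal (ε / 2) :=
    (measure_mono (Set.subset_univ A)).trans
      ((hreg.energyMeasure_univ_le _).trans (ENNReal.ofReal_le_ofReal h2))
  rw [Measure.add_apply, Measure.smul_apply, Measure.smul_apply, hm n hA, smul_eq_mul,
    smul_eq_mul, mul_zero, add_zero] at h1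
  rw [zero_add]
  refine h1.trans ((mul_le_mul_right h3 2).trans_eq ?_)
  rw [← ENNReal.ofReal_ofNat 2, ← ENNReal.ofReal_mul (by norm_num), mul_div_cancel₀ _ two_ne_zero,
    ENNReal.ofReal_coe_nnreal]

theorem IsRegular.energyMeasure_normalize_univ (hreg : E.IsRegular) {ψ : E.core}
    (hψ : 0 < E.coreForm ψ ψ) : E.energyMeasure (E.normalize ψ) Set.univ = 1 := by
  have := hreg.isFiniteMeasure_energyMeasure ψ
  have hT : 0 < (E.energyMeasure ψ Set.univ).toReal :=
    ENNReal.toReal_pos (hreg.energyMeasure_univ_pos hψ).ne' (measure_ne_top _ _)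
  rw [normalize, hreg.energyMeasure_smul, Measure.smul_apply, smul_eq_mul, inv_pow,
    Real.sq_sqrt hT.le, ENNReal.ofReal_inv_of_pos hT, ENNReal.ofReal_toReal (measure_ne_top _ _)]
  exact ENNReal.inv_mul_cancel (hreg.energyMeasure_univ_pos hψ).ne' (measure_ne_top _ _)

omit [SecondCountableTopology X] in
theorem IsRegular.sqrt_smul_normalize (hreg : E.IsRegular) {ψ : E.core}
    (hψ : 0 < E.coreForm ψ ψ) :
    Real.sqrt (E.energyMeasure ψ Set.univ).toReal • E.normalize ψ = ψ := by
  have := hreg.isFiniteMeasure_energyMeasure ψ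
  have hT : 0 < (E.energyMeasure ψ Set.univ).toReal :=
    ENNReal.toReal_pos (hreg.energyMeasure_univ_pos hψ).ne' (measure_ne_top _ _)
  rw [normalize, smul_inv_smul₀ (Real.sqrt_pos.2 hT).ne']

end Coordinates

end SymmDirichletForm

end

/-! ### The coordinate theorem -/

theorem theoremT {X : Type*} [TopologicalSpace X] [LocallyCompactSpace X]
    [SecondCountableTopology X] [T2Space X] [MeasurableSpace X] [BorelSpace X]
    (μ : Measure X) [IsFiniteMeasureOnCompacts μ] [μ.IsOpenPosMeasure]
    (E : SymmDirichletForm μ) (hreg : E.IsRegular) (hloc : E.IsLocal)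
    (ψ : ℕ → E.core)
    (hψ_dense : ∀ (u : E.domain) (ε : ℝ), 0 < ε →
      ∃ n, E.energyOne (u - E.coreIncl (ψ n)) < ε)
    (hψ_pos : ∀ n, 0 < E.form (E.coreIncl (ψ n)) (E.coreIncl (ψ n)))
    (f : ℕ → E.core) (hf : ∀ n, f n = E.normalize (ψ n))
    (m : Measure X) (hm : m = E.weightedEnergySum f) :
    IsFiniteMeasure m ∧ E.IsEnergyDominant m ∧ E.IsContinuousCoordinates f m := by
  have hfin := fun g => hreg.isFiniteMeasure_energyMeasure g
  have hψf : ∀ n, ∃ c : ℝ, c • f n = ψ n := fun n => by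
    rw [hf]
    exact ⟨_, hreg.sqrt_smul_normalize (hψ_pos n)⟩
  have hmfin : IsFiniteMeasure m := by
    rw [hm]
    refine SymmDirichletForm.isFiniteMeasure_weightedEnergySum fun n => ?_
    rw [hf]
    exact hreg.energyMeasure_normalize_univ (hψ_pos n)
  have hle : ∀ n, E.energyMeasure (f n) ≤ (2 : ℝ≥0∞) ^ n • m := fun n => by
    rw [hm]
    exact SymmDirichletForm.energyMeasure_le_weightedEnergySum f n
  have hac : ∀ n, E.energyMeasure (ψ n) ≪ m := fun n => by
    obtain ⟨c, hc⟩ := hψf n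
    rw [← hc, hreg.energyMeasure_smul]
    exact Measure.smul_absolutelyContinuous.trans (Measure.absolutelyContinuous_of_le_smul (hle n))
  refine ⟨hmfin, fun g => ?_, fun i j => ?_, fun _ h => h.exists_core, fun g ε hε => ?_⟩
  · obtain ⟨ρ, h1, h2⟩ := exists_withDensityᵥ_eq
      (hreg.absolutelyContinuous_energyMeasure hψ_dense hac g)
    exact ⟨ρ, h1, h2 ▸ (hreg.energyMeasure_spec g).choose_spec⟩
  -- Domination of Γ(fᵢ + fⱼ) by a multiple of m is what makes every term of the polarization
  -- formula have a bounded density.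
  · have hsum : E.energyMeasure (f i + f j) ≤
        ((2 : ℝ≥0∞) * 2 ^ i + 2 * 2 ^ j) • m := by
      refine (hreg.energyMeasure_add_le (f i) (f j)).trans ?_
      rw [add_smul, mul_smul, mul_smul]
      gcongr
      · exact hle i
      · exact hle j
    obtain ⟨ρ, h1, h2, h3⟩ := exists_bounded_withDensityᵥ_eq (by finiteness) hsum
    obtain ⟨ρ₁, h1₁, h2₁, h3₁⟩ := exists_bounded_withDensityᵥ_eq (by finiteness) (hle i)
    obtain ⟨ρ₂, h1₂, h2₂, h3₂⟩ := exists_bounded_withDensityᵥ_eq (by finiteness) (hle j)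
    exact ⟨(2 : ℝ)⁻¹ • (ρ - ρ₁ - ρ₂), ((h1.sub h1₁).sub h1₂).const_smul _,
      ((h2.sub h2₁).sub h2₂).const_smul _,
      hreg.isEnergyMeasure_polarization (f i) (f j) (memLp_one_iff_integrable.1 h1)
        (memLp_one_iff_integrable.1 h1₁) (memLp_one_iff_integrable.1 h1₂) h3 h3₁ h3₂⟩
  -- The approximant is ψₙ itself, a multiple of fₙ and therefore a cylinder function.
  · obtain ⟨n, hn⟩ := hψ_dense (E.coreIncl g) ε hε
    obtain ⟨c, hc⟩ := hψf n
    refine ⟨ψ n, ?_, ?_⟩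
    · rw [← hc]
      exact SymmDirichletForm.isCylinder_smul f n c
    · rwa [SymmDirichletForm.coreIncl_sub]
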